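/- **Setting.** Users form a homogeneous Poisson point process of density $\lambda>0$ in the plane. There are $N_f\ge 1$ files of $F>0$ bits; file $i$ is requested with the Zipf probability $p_r(i)=i^{-\beta}/\sum_{k=1}^{N_f}k^{-\beta}$ ($\beta\in\mathbb R$), and every user independently caches file $i$ with probability $p_c(i)\ge 0$, $\sum_i p_c(i)=1$; put $\lambda_i=\lambda p_c(i)$. A typical receiver at the origin requests file $i$ with probability $p_r(i)$ and, if the nearest user caching this file is at a distance $r<r_c$ ($r_c>0$), is served by it (the D2D transmitter, DT). With full reuse all DTs transmit at the same time: independently, a user caching file $i$ (other than the serving one) transmits with probability $1-p_s(i)$, where $p_s(i)=\int_0^{\pi r_c^2}e^{-\lambda p_r(i)x}g(x,\lambda_i)\,dx\Big/\int_0^{\pi r_c^2}g(x,\lambda_i)\,dx$ and $g(x,l)=\frac{3.5^{3.5}}{\Gamma(3.5)}l^{3.5}x^{2.5}e^{-3.5lx}$ is the fitted density of the area of a typical Poisson–Voronoi cell. All links have path loss exponent $\alpha>2$ and independent exponential power gains with mean $1$, and the noise has variance $\sigma^2>0$. With transmit power $P_t>0$ the SINR is $\gamma_1=\dfrac{P_t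 h r^{-\alpha}}{\sum_j P_t h_j r_j^{-\alpha}+\sigma^2}$, the sum running over the transmitting users other than the serving one, with gains $h_j$ and distances $r_j$ to the origin, and the energy needed to transmit the file is $E_1=\dfrac{F}{W\log_2(1+\gamma_1)}\Big(\dfrac{P_t}{\eta}+P_c\Big)$ (bandwidth $W>0$, amplifier efficiency $\eta>0$, circuit power $P_c\ge 0$). The transmission is complete if the serving user exists within distance $r_c$ and $E_1\le\rho V_0Q$, where $\rho,V_0,Q>0$ are the allowed battery fraction, the voltage and the battery capacity. **Notation.** $\Gamma_1=e^{\frac{F(P_t+\eta P_c)\ln 2}{W\rho QV_0\eta}}-1$, $f_i(r)=2\pi r\lambda_i e^{-\lambda_i\pi r^2}$, $\sigma_0^2=\sigma^2/P_t$, $\Gamma(s,x)=\int_x^\infty t^{s-1}e^{-t}dt$, and $$\theta_i=\frac{\Gamma(3.5,0)-\Gamma(3.5,(3.5\lambda_i+\lambda p_r(i))\pi r_c^2)}{\Gamma(3.5,0)-\Gamma(3.5,3.5\lambda_i\pi r_c^2)},\quad \lambda_i^d=\lambda_i\Big(1-\Big(1+\frac{\lambda p_r(i)}{3.5\lambda_i}\Big)^{-3.5}\theta_i\Big),\quad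 \lambda_I=\sum_{i=1}^{N_f}\lambda_i^d$$ (with $\lambda_i^d=0$ if $\lambda_i=0$), $\xi_1=\int_0^\infty\frac{dt}{1+t^{\alpha/2}}$, $\xi_2(x)=\int_0^{x^{-2/\alpha}}\frac{dt}{1+t^{\alpha/2}}$, $$\phi_i(x,y)=xy^\alpha\sigma_0^2+\pi\big(\lambda_I\xi_1-\lambda_i^d\,\xi_2(x)\big)y^2x^{2/\alpha},\qquad p_1=\sum_{i=1}^{N_f}p_r(i)\int_0^{r_c}f_i(r)e^{-\phi_i(\Gamma_1,r)}\,dr.$$ **Claim.** Almost surely the interference series converges; the probability of a complete transmission is $p_1>0$; and the average energy $\bar E_1=\mathbb E[E_1\mid\text{complete transmission}]$ consumed at a DT for a complete transmission exists and equals $$\bar E_1=\rho V_0Q-\rho V_0Q\sum_{i=1}^{N_f}\frac{p_r(i)}{p_1}\int_0^{r_c}f_i(r)\ln(1+\Gamma_1)\int_0^{\frac1{\ln(1+\Gamma_1)}}e^{-\phi_i(e^{1/t}-1,\,r)}\,dt\,dr .$$ -/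

import Mathlib

open MeasureTheory ProbabilityTheory Set
open scoped ENNReal NNReal

noncomputable section

/-- The plane in which the users live, with its Euclidean norm and Lebesgue measure. -/
abbrev Plane : Type := EuclideanSpace ℝ (Fin 2)

/-- Number (possibly infinite) of the points `X 0 ω, X 1 ω, …` that lie in `S`. -/
def pointCount {Ω : Type*} (X : ℕ → Ω → Plane) (S : Set Plane) (ω : Ω) : ℕ∞ :=
  Set.encard {j : ℕ | X j ω ∈ S}

/-- The random points `X 0, X 1, …` form a Poisson point process with intensity measure `ν`:
the number of points in a set of finite intensity is Poisson distributed, and the numbers of points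
in disjoint sets are independent. -/
structure IsPoissonProcess {Ω : Type*} [MeasurableSpace Ω] (X : ℕ → Ω → Plane)
    (ν : Measure Plane) (P : Measure Ω) : Prop where
  measurable_point : ∀ j, Measurable (X j)
  law_count : ∀ S : Set Plane, MeasurableSet S → ν S ≠ ∞ →
    HasLaw (pointCount X S) ((poissonMeasure (ν S).toNNReal).map (fun n : ℕ => (n : ℕ∞))) P
  indep_count : ∀ (m : ℕ) (S : Fin m → Set Plane), (∀ k, MeasurableSet (S k)) →
    (∀ k, ν (S k) ≠ ∞) → Pairwise (fun k l => Disjoint (S k) (S l)) →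
    iIndepFun (fun k => pointCount X (S k)) P

/-- The constants of the network; `N` is the number of files in the catalog.
File number `i + 1` of the catalog is represented by `i : Fin N`. -/
structure D2DParams (N : ℕ) where
  /-- density of the users -/
  lam : ℝ
  /-- collaboration distance -/
  rc : ℝ
  /-- exponent of the Zipf popularity law -/
  beta : ℝ
  /-- caching distribution -/
  pc : Fin N → ℝ
  /-- path loss exponent -/
  alpha : ℝ
  /-- transmit power -/
  Pt : ℝ
  /-- circuit power -/
  Pc : ℝ
  /-- power amplifier efficiency -/
  eta : ℝ
  /-- noise variance -/
  sigma2 : ℝ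
  /-- file size in bits -/
  F : ℝ
  /-- bandwidth -/
  W : ℝ
  /-- allowed fraction of the battery -/
  rho : ℝ
  /-- operating voltage -/
  V0 : ℝ
  /-- battery capacity -/
  Q : ℝ
  lam_pos : 0 < lam
  rc_pos : 0 < rc
  pc_nonneg : ∀ i, 0 ≤ pc i
  pc_sum : ∑ i, pc i = 1
  alpha_gt : 2 < alpha
  Pt_pos : 0 < Pt
  Pc_nonneg : 0 ≤ Pc
  eta_pos : 0 < eta
  sigma2_pos : 0 < sigma2
  F_pos : 0 < F
  W_pos : 0 < W
  rho_pos : 0 < rho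
  V0_pos : 0 < V0
  Q_pos : 0 < Q

namespace D2DParams

variable {N : ℕ} (D : D2DParams N)

/-- Zipf probability that a given file is requested. -/
def pr (i : Fin N) : ℝ :=
  ((i : ℝ) + 1) ^ (-D.beta) / ∑ k : Fin N, ((k : ℝ) + 1) ^ (-D.beta)

/-- Density of the users that cache file `i`. -/
def lamFile (i : Fin N) : ℝ := D.lam * D.pc i

/-- Energy that a transmitter may spend on one link. -/
def budget : ℝ := D.rho * D.V0 * D.Q

/-! ### The random network -/

/-- Fitted (Gamma) density of the area of a typical Poisson-Voronoi cell with point density `l`. -/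
def cellDensity (l x : ℝ) : ℝ :=
  (3.5 : ℝ) ^ (3.5 : ℝ) / Real.Gamma 3.5 * l ^ (3.5 : ℝ) * x ^ (2.5 : ℝ) * Real.exp (-3.5 * l * x)

/-- Probability that a user caching file `i` does not transmit: no user requesting file `i` lies in
its coverage area, whose law is the fitted cell law conditioned to be at most `π rc ^ 2`. -/
def silentProb (i : Fin N) : ℝ :=
  (∫ x in (0 : ℝ)..Real.pi * D.rc ^ 2,
      Real.exp (-(D.lam * D.pr i * x)) * cellDensity (D.lamFile i) x) /
    ∫ x in (0 : ℝ)..Real.pi * D.rc ^ 2, cellDensity (D.lamFile i) x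

/-- The random network seen from a typical receiver at the origin.
* `X j` is the position of the `j`-th user, `C j` the file that it caches;
* `A j` tells whether the `j`-th user transmits (to some other receiver);
* `H j` is the fading gain from the `j`-th user to the receiver at the origin;
* `J` is the file requested by the receiver, `G` the fading gain of its own link. -/
structure IsNetwork {Ω : Type*} [MeasurableSpace Ω] (P : Measure Ω) (X : ℕ → Ω → Plane)
    (C : ℕ → Ω → Fin N) (A : ℕ → Ω → Bool) (H : ℕ → Ω → ℝ) (J : Ω → Fin N) (G : Ω → ℝ) :
    Prop where
  users : IsPoissonProcess X (ENNReal.ofReal D.lam • (volume : Measure Plane)) P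
  measurable_cache : ∀ j, Measurable (C j)
  measurable_active : ∀ j, Measurable (A j)
  measurable_fading : ∀ j, Measurable (H j)
  measurable_request : Measurable J
  measurable_gain : Measurable G
  law_cache : ∀ j i, P.real {ω | C j ω = i} = D.pc i
  law_active : ∀ j i, P.real {ω | C j ω = i ∧ A j ω = true} = D.pc i * (1 - D.silentProb i)
  law_fading : ∀ j, HasLaw (H j) (expMeasure 1) P
  law_request : ∀ i, P.real {ω | J ω = i} = D.pr i
  law_gain : HasLaw G (expMeasure 1) P
  /- the marks of different users are independent, and the fading of a user is independent of its
  cache and activity -/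
  indep_users : iIndepFun (fun j ω => (C j ω, A j ω, H j ω)) P
  indep_fading : ∀ j, IndepFun (fun ω => (C j ω, A j ω)) (H j) P
  /- positions, marks, request and gain are mutually independent -/
  indep_positions : IndepFun (fun ω (j : ℕ) => X j ω)
    (fun ω => ((fun j : ℕ => (C j ω, A j ω, H j ω)), J ω, G ω)) P
  indep_marks : IndepFun (fun ω (j : ℕ) => (C j ω, A j ω, H j ω)) (fun ω => (J ω, G ω)) P
  indep_request : IndepFun J G P

section Link

variable {Ω : Type*} (X : ℕ → Ω → Plane) (C : ℕ → Ω → Fin N) (A : ℕ → Ω → Bool)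
  (H : ℕ → Ω → ℝ) (J : Ω → Fin N) (G : Ω → ℝ)

/-- Distance from the origin to the nearest user caching file `i` (`∞` if there is none). -/
def nearest (i : Fin N) (ω : Ω) : ℝ≥0∞ := ⨅ j : ℕ, ⨅ _ : C j ω = i, ‖X j ω‖ₑ

/-- Contribution of the `j`-th user to the interference (normalized by the transmit power) for a
receiver of file `i` that is served by the nearest user caching file `i`, at distance `r`: any other
transmitting user interferes, so those caching file `i` are at distance greater than `r`. -/
def interferenceTerm (i : Fin N) (r : ℝ) (ω : Ω) (j : ℕ) : ℝ :=
  if A j ω = true ∧ (C j ω = i → r < ‖X j ω‖) then H j ω * ‖X j ω‖ ^ (-D.alpha) else 0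

/-- Signal to interference plus noise ratio. -/
def sinr (i : Fin N) (r : ℝ) (ω : Ω) : ℝ :=
  D.Pt * G ω * r ^ (-D.alpha) /
    ((∑' j, D.Pt * D.interferenceTerm X C A H i r ω j) + D.sigma2)

/-- Data rate. -/
def rate (i : Fin N) (r : ℝ) (ω : Ω) : ℝ :=
  D.W * Real.logb 2 (1 + D.sinr X C A H G i r ω)

/-- Energy needed to transmit file `i` over a link of length `r`. -/
def energy (i : Fin N) (r : ℝ) (ω : Ω) : ℝ :=
  D.F / D.rate X C A H G i r ω * (1 / D.eta * D.Pt + D.Pc)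

/-- Energy needed to transmit the requested file to the receiver at the origin from the nearest user
caching it. -/
def linkEnergy (ω : Ω) : ℝ := D.energy X C A H G (J ω) (nearest X C (J ω) ω).toReal ω

/-- Complete transmission: a user within the collaboration distance caches the requested file, and
the energy needed by the nearest such user is within the allowed budget. -/
def complete : Set Ω :=
  {ω | nearest X C (J ω) ω < ENNReal.ofReal D.rc ∧ D.linkEnergy X C A H J G ω ≤ D.budget}

end Link

/-! ### The quantities of the closed form -/

/-- Upper incomplete Gamma function. -/
def upperGamma (s x : ℝ) : ℝ := ∫ t in Ioi x, t ^ (s - 1) * Real.exp (-t)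

def theta (i : Fin N) : ℝ :=
  (upperGamma 3.5 0 -
      upperGamma 3.5 ((3.5 * D.lamFile i + D.lam * D.pr i) * Real.pi * D.rc ^ 2)) /
    (upperGamma 3.5 0 - upperGamma 3.5 (3.5 * D.lamFile i * Real.pi * D.rc ^ 2))

/-- Density of the transmitters caching file `i` (zero if no user caches file `i`). -/
def lamDT (i : Fin N) : ℝ :=
  D.lamFile i *
    (1 - (1 + D.lam * D.pr i / (3.5 * D.lamFile i)) ^ (-3.5 : ℝ) * D.theta i)

/-- Density of all transmitters. -/
def lamI : ℝ := ∑ i, D.lamDT i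

def xi1 : ℝ := ∫ t in Ioi (0 : ℝ), 1 / (1 + t ^ (D.alpha / 2))

def xi2 (x : ℝ) : ℝ := ∫ t in (0 : ℝ)..x ^ (-(2 / D.alpha)), 1 / (1 + t ^ (D.alpha / 2))

def phi (i : Fin N) (x y : ℝ) : ℝ :=
  x * y ^ D.alpha * (D.sigma2 / D.Pt) +
    Real.pi * (D.lamI * D.xi1 - D.lamDT i * D.xi2 x) * y ^ 2 * x ^ (2 / D.alpha)

/-- Density of the link distance. -/
def linkPdf (i : Fin N) (r : ℝ) : ℝ :=
  2 * Real.pi * r * D.lamFile i * Real.exp (-(D.lamFile i * Real.pi * r ^ 2))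

/-- SINR threshold for a complete transmission. -/
def Gamma1 : ℝ :=
  Real.exp (D.F * (D.Pt + D.eta * D.Pc) * Real.log 2 / (D.W * D.rho * D.Q * D.V0 * D.eta)) - 1

/-- Closed form of the offloading probability. -/
def p1 : ℝ :=
  ∑ i, D.pr i * ∫ r in (0 : ℝ)..D.rc, D.linkPdf i r * Real.exp (-D.phi i D.Gamma1 r)

end D2DParams

end

set_option linter.unusedSectionVars false

noncomputable section

open Filter Topology

/-! The SINR of the link to the nearest user caching the requested file is `G / L`, where `L`
(`linkLoad`) is `R ^ α` times interference plus normalized noise and `R` is the link distance. Since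
`G` is exponential and independent of the rest, the SINR reaches `x` with conditional probability
`exp (-x L)`. Everything therefore rests on the function `coverage`, the mean of `exp (-x L)` on the
event `R < r`.

The Poisson process is known only through its counts, so no Palm or Slivnyak calculus is used to
condition on `R`. Instead, the Laplace functional of the marked process is derived from the counts
(`tendsto_lintegral_prod`, `IsPoissonProcess.lintegral_marked_prod`). Applied to `markFactor`, it
gives in closed form the mean of `exp (-s I)` on the event that no user of file `i` is closer than
`a`, where `I` counts the users of file `i` only beyond a second radius `b ≥ a`
(`lintegral_prod_markFactor`, `integral_exp_interference`). Differences in `a` with `b` fixed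
localize `R` in `[a, b)`.

On that event, `R` may be replaced by `a` or `b` in the path loss, and the interference beyond `R`
by that beyond `b`. The latter is exact unless the annulus holds two points, which has probability
`O((b - a) ^ 2)`. Squeezing the difference quotients shows that `coverage` has right derivative
`linkPdf * exp (-phi)` (`hasDerivWithinAt_coverage`), and a continuous function is recovered from
its right derivative (`coverage_eq`). The interference converges almost surely because its Laplace
transform tends to `1` at `0`.

For the energy, put `K = energyScale`, so that `E = K / ln (1 + SINR)`. Then `E ≤ e` means that the
SINR is at least `exp (K / e) - 1`, which gives the law of `E`, and `p1` at `e = budget`. The layer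
cake formula for the saved energy `budget - E`, the substitution `e = K t` and Fubini's theorem
yield the mean (`setIntegral_saved_energy`, `setIntegral_linkEnergy`). -/

/-! ### Laplace functional of a Poisson process, from its counts. -/

theorem integral_pow_poissonMeasure (r : ℝ≥0) (c : ℝ) :
    ∫ n : ℕ, c ^ n ∂(poissonMeasure r) = Real.exp (-(r * (1 - c))) := by
  rw [integral_poissonMeasure]
  have h : ∀ n : ℕ, (Real.exp (-(r : ℝ)) * (r : ℝ) ^ n / (n.factorial : ℝ)) • c ^ n =
      Real.exp (-r) * (((r : ℝ) * c) ^ n / (n.factorial : ℝ)) := by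
    intro n; rw [smul_eq_mul, mul_pow]; ring
  simp_rw [h]
  rw [tsum_mul_left, (NormedSpace.expSeries_div_hasSum_exp ((r : ℝ) * c)).tsum_eq,
    ← Real.exp_eq_exp_ℝ, ← Real.exp_add]
  congr 1; ring

namespace IsPoissonProcess

variable {Ω : Type*} [MeasurableSpace Ω] {X : ℕ → Ω → Plane} {ν : Measure Plane} {P : Measure Ω}

theorem ae_pointCount_ne_top (h : IsPoissonProcess X ν P) {S : Set Plane} (hS : MeasurableSet S)
    (hν : ν S ≠ ∞) : ∀ᵐ ω ∂P, pointCount X S ω ≠ ⊤ := by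
  have hl := h.law_count S hS hν
  have h2 := hl.measure_eq (p := fun n => n = ⊤) (MeasurableSet.of_discrete)
  rw [ae_iff]
  simp only [not_not]
  rw [h2, Measure.map_apply (measurable_of_countable _) (MeasurableSet.of_discrete)]
  have : (fun n : ℕ => (n : ℕ∞)) ⁻¹' {x | x = ⊤} = ∅ := by ext n; simp
  rw [this, measure_empty]

theorem integral_pow_pointCount (h : IsPoissonProcess X ν P) {S : Set Plane}
    (hS : MeasurableSet S) (hν : ν S ≠ ∞) (c : ℝ) :
    ∫ ω, c ^ (pointCount X S ω).toNat ∂P = Real.exp (-((ν S).toReal * (1 - c))) := by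
  have hl := h.law_count S hS hν
  have h1 : ∫ ω, c ^ (pointCount X S ω).toNat ∂P
      = ∫ n : ℕ∞, c ^ n.toNat ∂(P.map (pointCount X S)) := by
    rw [integral_map hl.aemeasurable]
    exact (measurable_of_countable _).aestronglyMeasurable
  rw [h1, hl.map_eq, integral_map (measurable_of_countable _).aemeasurable
    (measurable_of_countable _).aestronglyMeasurable]
  simp only [ENat.toNat_natCast]
  rw [integral_pow_poissonMeasure]
  rfl

/-- A product over all points of a simple function of the point is a product of powers. -/
theorem prod_simple_eq {x : ℕ → Plane} (s : SimpleFunc Plane ℝ≥0∞)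
    (hfin : ∀ y ∈ s.range.erase 0, {j : ℕ | x j ∈ s ⁻¹' {y}}.Finite) :
    ∀ᶠ n in atTop, ∏ j ∈ Finset.range n, (1 - s (x j)) =
      ∏ y ∈ s.range.erase 0, (1 - y) ^ ({j : ℕ | x j ∈ s ⁻¹' {y}}.encard).toNat := by
  classical
  have hT : {j : ℕ | s (x j) ≠ 0}.Finite := by
    refine ((s.range.erase 0).finite_toSet.biUnion (t := fun y => {j : ℕ | x j ∈ s ⁻¹' {y}})
      hfin).subset ?_
    intro j hj
    simp only [mem_ofPred_eq, mem_iUnion, mem_preimage, mem_singleton_iff, Finset.mem_coe] at hj ⊢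
    exact ⟨s (x j), Finset.mem_erase.2 ⟨hj, SimpleFunc.mem_range_self _ _⟩, rfl⟩
  obtain ⟨m, hm⟩ := hT.bddAbove
  filter_upwards [eventually_ge_atTop (m + 1)] with n hn
  have hsub : hT.toFinset ⊆ Finset.range n := by
    intro j hj
    have := hm ((Set.Finite.mem_toFinset _).1 hj)
    simp only [Finset.mem_range]; omega
  rw [← Finset.prod_subset hsub (f := fun j => 1 - s (x j))]
  · rw [← Finset.prod_fiberwise_of_maps_to (t := s.range.erase 0) (g := fun j => s (x j))]
    · refine Finset.prod_congr rfl fun y hy => ?_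
      rw [Finset.prod_congr rfl (g := fun _ => 1 - y), Finset.prod_const]
      · congr 1
        have he : {j : ℕ | x j ∈ s ⁻¹' {y}} =
            ((hT.toFinset.filter fun j => s (x j) = y : Finset ℕ) : Set ℕ) := by
          ext j
          simp only [mem_preimage, mem_singleton_iff, mem_ofPred_eq, Finset.coe_filter,
            Set.Finite.mem_toFinset]
          constructor
          · intro h; exact ⟨by rw [h]; exact (Finset.mem_erase.1 hy).1, h⟩
          · exact fun h => h.2
        rw [he, Set.encard_coe_eq_coe_finsetCard, ENat.toNat_natCast]
      · intro j hj; rw [(Finset.mem_filter.1 hj).2]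
    · intro j hj
      exact Finset.mem_erase.2 ⟨(Set.Finite.mem_toFinset _).1 hj, SimpleFunc.mem_range_self _ _⟩
  · intro j _ hj
    have : s (x j) = 0 := by by_contra h; exact hj ((Set.Finite.mem_toFinset _).2 h)
    simp [this]

/-- The level sets are disjoint, so their counts are independent Poisson variables and the mean is
the product of the generating functions at `1 - y`; the exponents `y * ν {s = y}` add up to the
integral of `s`. The level `0` is left out because it may have infinite intensity. -/
theorem lintegral_prod_pow [IsProbabilityMeasure P] (h : IsPoissonProcess X ν P)
    (s : SimpleFunc Plane ℝ≥0∞)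
    (hs : ∀ x, s x ≤ 1) (hν : ∀ y ∈ s.range.erase 0, ν (s ⁻¹' {y}) ≠ ∞) :
    ∫⁻ ω, ∏ y ∈ s.range.erase 0, (1 - y) ^ (pointCount X (s ⁻¹' {y}) ω).toNat ∂P =
      ENNReal.ofReal (Real.exp (-(∫⁻ x, s x ∂ν).toReal)) := by
  classical
  set R := s.range.erase 0 with hR
  have hle : ∀ y ∈ R, y ≤ 1 := by
    intro y hy
    obtain ⟨x, rfl⟩ := SimpleFunc.mem_range.1 (Finset.mem_erase.1 hy).2
    exact hs x
  have hconv : ∀ ω, ∏ y ∈ R, (1 - y) ^ (pointCount X (s ⁻¹' {y}) ω).toNat =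
      ENNReal.ofReal (∏ y ∈ R, (1 - y.toReal) ^ (pointCount X (s ⁻¹' {y}) ω).toNat) := by
    intro ω
    rw [ENNReal.ofReal_prod_of_nonneg]
    · refine Finset.prod_congr rfl fun y hy => ?_
      have : y.toReal ≤ 1 := ENNReal.toReal_le_of_le_ofReal zero_le_one (by simpa using hle y hy)
      rw [ENNReal.ofReal_pow (by linarith), ENNReal.ofReal_sub _ ENNReal.toReal_nonneg,
        ENNReal.ofReal_one, ENNReal.ofReal_toReal (ne_top_of_le_ne_top ENNReal.one_ne_top (hle y hy))]
    · intro y hy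
      have : y.toReal ≤ 1 := ENNReal.toReal_le_of_le_ofReal zero_le_one (by simpa using hle y hy)
      exact pow_nonneg (by linarith) _
  simp_rw [hconv]
  have hae : ∀ y ∈ R, AEMeasurable (pointCount X (s ⁻¹' {y})) P := fun y hy =>
    (h.law_count _ (s.measurableSet_preimage _) (hν y hy)).aemeasurable
  have hpow : ∀ y ∈ R,
      AEMeasurable (fun ω => (1 - y.toReal) ^ (pointCount X (s ⁻¹' {y}) ω).toNat) P := fun y hy =>
    (measurable_of_countable (fun n : ℕ∞ => (1 - y.toReal) ^ n.toNat)).comp_aemeasurable (hae y hy)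
  have hb : ∀ ω, ∀ y ∈ R, 0 ≤ (1 - y.toReal) ^ (pointCount X (s ⁻¹' {y}) ω).toNat ∧
      (1 - y.toReal) ^ (pointCount X (s ⁻¹' {y}) ω).toNat ≤ 1 := by
    intro ω y hy
    have h1 : y.toReal ≤ 1 := ENNReal.toReal_le_of_le_ofReal zero_le_one (by simpa using hle y hy)
    have h0 : 0 ≤ y.toReal := ENNReal.toReal_nonneg
    exact ⟨pow_nonneg (by linarith) _, pow_le_one₀ (by linarith) (by linarith)⟩
  rw [← ofReal_integral_eq_lintegral_ofReal]
  rotate_left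
  · refine Integrable.of_bound (C := 1) (Finset.aestronglyMeasurable_fun_prod _ fun y hy =>
      (hpow y hy).aestronglyMeasurable) (ae_of_all _ fun ω => ?_)
    rw [Real.norm_of_nonneg (Finset.prod_nonneg fun y hy => (hb ω y hy).1)]
    exact Finset.prod_le_one (fun y hy => (hb ω y hy).1) (fun y hy => (hb ω y hy).2)
  · exact ae_of_all _ fun ω => Finset.prod_nonneg fun y hy => (hb ω y hy).1
  congr 1
  let e := R.equivFin
  have hre : ∀ ω, ∏ y ∈ R, (1 - y.toReal) ^ (pointCount X (s ⁻¹' {y}) ω).toNat =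
      ∏ k : Fin R.card, (1 - (e.symm k : ℝ≥0∞).toReal) ^
        (pointCount X (s ⁻¹' {(e.symm k : ℝ≥0∞)}) ω).toNat := by
    intro ω
    rw [← Finset.prod_coe_sort R
      (fun y => (1 - y.toReal) ^ (pointCount X (s ⁻¹' {y}) ω).toNat)]
    exact (Equiv.prod_comp e.symm (fun y : R => (1 - (y : ℝ≥0∞).toReal) ^
        (pointCount X (s ⁻¹' {(y : ℝ≥0∞)}) ω).toNat)).symm
  simp_rw [hre]
  have hind := h.indep_count R.card (fun k => s ⁻¹' {(e.symm k : ℝ≥0∞)})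
    (fun k => s.measurableSet_preimage _) (fun k => hν _ (e.symm k).2) (by
      intro k l hkl
      refine Disjoint.preimage _ ?_
      simp only [disjoint_singleton_left, mem_singleton_iff]
      intro hh
      exact hkl (e.symm.injective (Subtype.ext hh)))
  rw [hind.integral_fun_prod_comp (f := fun k n => (1 - (e.symm k : ℝ≥0∞).toReal) ^ n.toNat)
    (fun k => hae _ (e.symm k).2) (fun k => (measurable_of_countable _).aestronglyMeasurable)]
  have h2 : ∀ k, ∫ ω, (1 - (e.symm k : ℝ≥0∞).toReal) ^
      (pointCount X (s ⁻¹' {(e.symm k : ℝ≥0∞)}) ω).toNat ∂P =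
      Real.exp (-((ν (s ⁻¹' {(e.symm k : ℝ≥0∞)})).toReal * (e.symm k : ℝ≥0∞).toReal)) := by
    intro k
    rw [h.integral_pow_pointCount (s.measurableSet_preimage _) (hν _ (e.symm k).2)]
    congr 2; ring
  simp_rw [h2]
  rw [← Real.exp_sum, Equiv.sum_comp e.symm
    (fun y : R => -((ν (s ⁻¹' {(y : ℝ≥0∞)})).toReal * (y : ℝ≥0∞).toReal)),
    Finset.sum_coe_sort R (fun y => -((ν (s ⁻¹' {y})).toReal * y.toReal)), Finset.sum_neg_distrib]
  congr 2
  rw [SimpleFunc.lintegral_eq_lintegral, SimpleFunc.lintegral,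
    ← Finset.sum_subset (Finset.erase_subset 0 s.range), ENNReal.toReal_sum]
  · refine Finset.sum_congr rfl fun y _ => ?_
    rw [ENNReal.toReal_mul, mul_comm]
  · intro y hy
    exact ENNReal.mul_ne_top (ne_top_of_le_ne_top ENNReal.one_ne_top (hle y hy)) (hν y hy)
  · intro y hy hy'
    have : y = 0 := by by_contra h0; exact hy' (Finset.mem_erase.2 ⟨h0, hy⟩)
    simp [this]

/-- Almost surely only finitely many points lie where `s` is nonzero, so the partial products are
eventually constant; they are dominated by `1`. -/
theorem tendsto_lintegral_prod_simple [IsProbabilityMeasure P] (h : IsPoissonProcess X ν P)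
    (s : SimpleFunc Plane ℝ≥0∞) (hs : ∀ x, s x ≤ 1)
    (hν : ∀ y ∈ s.range.erase 0, ν (s ⁻¹' {y}) ≠ ∞) :
    Tendsto (fun n => ∫⁻ ω, ∏ j ∈ Finset.range n, (1 - s (X j ω)) ∂P) atTop
      (𝓝 (ENNReal.ofReal (Real.exp (-(∫⁻ x, s x ∂ν).toReal)))) := by
  rw [← h.lintegral_prod_pow s hs hν]
  refine tendsto_lintegral_of_dominated_convergence (fun _ => 1) ?_ ?_ (by simp) ?_
  · intro n
    exact Finset.measurable_fun_prod _ fun j _ =>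
      measurable_const.sub (s.measurable.comp (h.measurable_point j))
  · exact fun n => ae_of_all _ fun ω => Finset.prod_le_one' fun j _ => tsub_le_self
  · have hall : ∀ᵐ ω ∂P, ∀ y ∈ s.range.erase 0, pointCount X (s ⁻¹' {y}) ω ≠ ⊤ := by
      refine (ae_ball_iff (Finset.countable_toSet (s.range.erase 0))).2 ?_
      exact fun y hy => h.ae_pointCount_ne_top (s.measurableSet_preimage _) (hν y hy)
    filter_upwards [hall] with ω hω
    refine tendsto_const_nhds.congr' ?_
    filter_upwards [prod_simple_eq (x := fun j => X j ω) s
      (fun y hy => Set.encard_ne_top_iff.1 (hω y hy))] with n hn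
    exact hn.symm

/-- Laplace functional of a Poisson process, in product form. -/
theorem tendsto_lintegral_prod [IsProbabilityMeasure P] (h : IsPoissonProcess X ν P)
    {v : Plane → ℝ≥0∞} (hv : Measurable v) (hv1 : ∀ x, v x ≤ 1) (hvν : ∫⁻ x, v x ∂ν ≠ ∞) :
    Tendsto (fun n => ∫⁻ ω, ∏ j ∈ Finset.range n, (1 - v (X j ω)) ∂P) atTop
      (𝓝 (ENNReal.ofReal (Real.exp (-(∫⁻ x, v x ∂ν).toReal)))) := by
  have hanti : ∀ f : Plane → ℝ≥0∞,
      Antitone (fun n => ∫⁻ ω, ∏ j ∈ Finset.range n, (1 - f (X j ω)) ∂P) := by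
    intro f m n hmn
    refine lintegral_mono fun ω => ?_
    exact Finset.prod_le_prod_of_subset_of_le_one' (Finset.range_mono hmn)
      (fun j _ _ => tsub_le_self)
  set s : ℕ → SimpleFunc Plane ℝ≥0∞ := fun k => SimpleFunc.eapprox v k with hsdef
  have hsv : ∀ k x, s k x ≤ v x := fun k x => by
    rw [← SimpleFunc.iSup_eapprox_apply hv x]
    exact le_iSup (fun k => SimpleFunc.eapprox v k x) k
  have hsmono : ∀ x, Monotone fun k => s k x := fun x k l hkl => SimpleFunc.monotone_eapprox v hkl x
  have hE : ∀ k, ⨅ n, ∫⁻ ω, ∏ j ∈ Finset.range n, (1 - s k (X j ω)) ∂P =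
      ENNReal.ofReal (Real.exp (-(∫⁻ x, s k x ∂ν).toReal)) := by
    intro k
    refine tendsto_nhds_unique (tendsto_atTop_iInf (hanti _))
      (h.tendsto_lintegral_prod_simple (s k) (fun x => (hsv k x).trans (hv1 x)) ?_)
    intro y hy
    have hlt : (s k).lintegral ν ≠ ∞ := by
      rw [← SimpleFunc.lintegral_eq_lintegral]
      exact ne_top_of_le_ne_top hvν (lintegral_mono (hsv k))
    exact ((SimpleFunc.FinMeasSupp.of_lintegral_ne_top hlt).meas_preimage_singleton_ne_zero
      (Finset.mem_erase.1 hy).1).ne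
  have hK : ∀ n, ⨅ k, ∫⁻ ω, ∏ j ∈ Finset.range n, (1 - s k (X j ω)) ∂P =
      ∫⁻ ω, ∏ j ∈ Finset.range n, (1 - v (X j ω)) ∂P := by
    intro n
    have hmeas : ∀ k, Measurable fun ω => ∏ j ∈ Finset.range n, (1 - s k (X j ω)) := fun k =>
      Finset.measurable_fun_prod _ fun j _ =>
        measurable_const.sub ((s k).measurable.comp (h.measurable_point j))
    have ha : Antitone fun k => fun ω => ∏ j ∈ Finset.range n, (1 - s k (X j ω)) :=
      fun k l hkl ω => Finset.prod_le_prod' fun j _ => tsub_le_tsub_left (hsmono _ hkl) _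
    rw [← lintegral_iInf hmeas ha]
    · refine lintegral_congr fun ω => ?_
      refine tendsto_nhds_unique (tendsto_atTop_iInf fun k l hkl => ha hkl ω) ?_
      refine ENNReal.tendsto_finsetProd_of_ne_top _ (fun j _ => ?_)
        fun j _ => ne_top_of_le_ne_top ENNReal.one_ne_top tsub_le_self
      exact ENNReal.Tendsto.sub tendsto_const_nhds (SimpleFunc.tendsto_eapprox hv _)
        (Or.inl ENNReal.one_ne_top)
    · refine ne_top_of_le_ne_top ENNReal.one_ne_top ?_
      calc _ ≤ ∫⁻ ω, 1 ∂P := lintegral_mono fun ω => Finset.prod_le_one' fun j _ => tsub_le_self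
        _ = 1 := by simp
  have hlim : Tendsto (fun k => ENNReal.ofReal (Real.exp (-(∫⁻ x, s k x ∂ν).toReal))) atTop
      (𝓝 (ENNReal.ofReal (Real.exp (-(∫⁻ x, v x ∂ν).toReal)))) := by
    refine ENNReal.tendsto_ofReal ((Real.continuous_exp.tendsto _).comp
      (((ENNReal.tendsto_toReal hvν).comp ?_).neg))
    refine lintegral_tendsto_of_tendsto_of_monotone (fun k => (s k).measurable.aemeasurable)
      (ae_of_all _ hsmono) (ae_of_all _ fun x => SimpleFunc.tendsto_eapprox hv x)
  have hantiE : Antitone fun k => ENNReal.ofReal (Real.exp (-(∫⁻ x, s k x ∂ν).toReal)) := by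
    intro k l hkl
    refine ENNReal.ofReal_le_ofReal (Real.exp_le_exp.2 (neg_le_neg ?_))
    exact ENNReal.toReal_mono (ne_top_of_le_ne_top hvν (lintegral_mono (hsv l)))
      (lintegral_mono fun x => hsmono x hkl)
  rw [tendsto_nhds_unique hlim (tendsto_atTop_iInf hantiE)]
  simp_rw [← hE]
  -- The products decrease both in the number `n` of points and in the index `k` of the increasing
  -- approximation, so both limits are infima and can be exchanged.
  rw [iInf_comm]
  simp_rw [hK]
  exact tendsto_atTop_iInf (hanti v)

end IsPoissonProcess

/-! ### Averaging out independent marks. -/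

section Marks

variable {Ω : Type*} [MeasurableSpace Ω] {P : Measure Ω} [IsProbabilityMeasure P]
  {E M : Type*} [MeasurableSpace E] [MeasurableSpace M] {x : ℕ → Ω → E} {m : ℕ → Ω → M}

/-- Independent marks can be averaged out of a product over marked points. -/
theorem lintegral_prod_marks (hx : ∀ j, Measurable (x j)) (hm : ∀ j, Measurable (m j))
    (hxm : IndepFun (fun ω j => x j ω) (fun ω j => m j ω) P) (hind : iIndepFun m P)
    {w : E → M → ℝ≥0∞} (hw : Measurable (Function.uncurry w)) {wb : E → ℝ≥0∞}
    (hwb : ∀ j e, ∫⁻ ω, w e (m j ω) ∂P = wb e) (n : ℕ) :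
    ∫⁻ ω, ∏ j ∈ Finset.range n, w (x j ω) (m j ω) ∂P =
      ∫⁻ ω, ∏ j ∈ Finset.range n, wb (x j ω) ∂P := by
  have hX : Measurable fun ω j => x j ω := measurable_pi_lambda _ hx
  have hM : Measurable fun ω j => m j ω := measurable_pi_lambda _ hm
  have hmap := hxm.map_prod_eq_prod_map_map hX.aemeasurable hM.aemeasurable
  have hwbm : Measurable wb := by
    have : wb = fun e => ∫⁻ y, w e y ∂(P.map (m 0)) := by
      funext e
      exact (hwb 0 e).symm.trans
        (lintegral_map (f := w e) (hw.comp measurable_prodMk_left) (hm 0)).symm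
    rw [this]
    have : IsProbabilityMeasure (P.map (m 0)) := Measure.isProbabilityMeasure_map (hm 0).aemeasurable
    exact hw.lintegral_prod_right'
  have hF : Measurable fun p : (ℕ → E) × (ℕ → M) => ∏ j ∈ Finset.range n, w (p.1 j) (p.2 j) :=
    Finset.measurable_fun_prod _ fun j _ => hw.comp
      (g := Function.uncurry w) (f := fun p : (ℕ → E) × (ℕ → M) => (p.1 j, p.2 j)) (by fun_prop)
  have : IsProbabilityMeasure (P.map fun ω j => m j ω) :=
    Measure.isProbabilityMeasure_map hM.aemeasurable
  calc ∫⁻ ω, ∏ j ∈ Finset.range n, w (x j ω) (m j ω) ∂P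
      = ∫⁻ p, ∏ j ∈ Finset.range n, w (p.1 j) (p.2 j)
          ∂(P.map fun ω => ((fun j => x j ω), fun j => m j ω)) :=
        (lintegral_map hF (hX.prodMk hM)).symm
    _ = ∫⁻ e, ∫⁻ y, ∏ j ∈ Finset.range n, w (e j) (y j) ∂(P.map fun ω j => m j ω)
          ∂(P.map fun ω j => x j ω) := by
        rw [hmap, lintegral_prod _ hF.aemeasurable]
    _ = ∫⁻ e, ∏ j ∈ Finset.range n, wb (e j) ∂(P.map fun ω j => x j ω) := by
        refine lintegral_congr fun e => ?_
        have hwe : ∀ j, Measurable (w (e j)) := fun j => hw.comp measurable_prodMk_left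
        rw [lintegral_map (f := fun y : ℕ → M => ∏ j ∈ Finset.range n, w (e j) (y j))
          (Finset.measurable_fun_prod _ fun j _ => (hwe j).comp (measurable_pi_apply j)) hM]
        -- With the positions frozen, the factors are functions of independent marks.
        rw [lintegral_prod_eq_prod_lintegral_of_indepFun (Finset.range n)
          (fun j ω => w (e j) (m j ω)) (hind.comp (fun j => w (e j)) hwe)
          (fun j => (hwe j).comp (hm j))]
        exact Finset.prod_congr rfl fun j _ => hwb j _
    _ = ∫⁻ ω, ∏ j ∈ Finset.range n, wb (x j ω) ∂P :=
        lintegral_map (Finset.measurable_fun_prod _ fun j _ =>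
          hwbm.comp (measurable_pi_apply j)) hX

/-- Laplace functional of an independently marked Poisson process. -/
theorem IsPoissonProcess.lintegral_marked_prod {X : ℕ → Ω → Plane} {ν : Measure Plane}
    (h : IsPoissonProcess X ν P) (hm : ∀ j, Measurable (m j))
    (hxm : IndepFun (fun ω j => X j ω) (fun ω j => m j ω) P) (hind : iIndepFun m P)
    {w : Plane → M → ℝ≥0∞} (hw : Measurable (Function.uncurry w)) {v : Plane → ℝ≥0∞}
    (hv : Measurable v) (hv1 : ∀ x, v x ≤ 1) (hvν : ∫⁻ x, v x ∂ν ≠ ∞)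
    (hwb : ∀ j e, ∫⁻ ω, w e (m j ω) ∂P = 1 - v e)
    (hw1 : ∀ᵐ ω ∂P, ∀ j, w (X j ω) (m j ω) ≤ 1) {L : Ω → ℝ≥0∞}
    (hL : ∀ᵐ ω ∂P, Tendsto (fun n => ∏ j ∈ Finset.range n, w (X j ω) (m j ω)) atTop (𝓝 (L ω))) :
    ∫⁻ ω, L ω ∂P = ENNReal.ofReal (Real.exp (-(∫⁻ x, v x ∂ν).toReal)) := by
  refine tendsto_nhds_unique (tendsto_lintegral_of_dominated_convergence (fun _ => 1)
    ?_ ?_ (by simp) hL) ?_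
  · intro n
    exact Finset.measurable_fun_prod _ fun j _ => hw.comp ((h.measurable_point j).prodMk (hm j))
  · intro n
    filter_upwards [hw1] with ω hω using Finset.prod_le_one' fun j _ => hω j
  · simp_rw [lintegral_prod_marks h.measurable_point hm hxm hind hw hwb]
    exact h.tendsto_lintegral_prod hv hv1 hvν

end Marks

/-! ### Exponential gains. -/

section Exponential

variable {Ω : Type*} [MeasurableSpace Ω] {P : Measure Ω}

theorem integral_exp_neg_mul_expMeasure {u : ℝ} (hu : 0 ≤ u) :
    ∫ x, Real.exp (-(u * x)) ∂(expMeasure 1) = 1 / (1 + u) := by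
  have h1 : expMeasure 1 = (volume : Measure ℝ).withDensity (exponentialPDF 1) := rfl
  rw [h1, integral_withDensity_eq_integral_toReal_smul (f := exponentialPDF 1)
    (measurable_exponentialPDFReal 1).ennreal_ofReal (ae_of_all _ fun x => ENNReal.ofReal_lt_top)]
  have h2 : ∀ x, (exponentialPDF 1 x).toReal • Real.exp (-(u * x)) =
      (Ici (0 : ℝ)).indicator (fun x => Real.exp (-(1 + u) * x)) x := by
    intro x
    rw [exponentialPDF_eq]
    by_cases hx : 0 ≤ x
    · rw [if_pos hx, indicator_of_mem (by exact hx), ENNReal.toReal_ofReal (by positivity),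
        smul_eq_mul, one_mul, ← Real.exp_add]
      congr 1; ring
    · rw [if_neg hx, indicator_of_notMem (by exact hx)]; simp
  simp_rw [h2]
  rw [integral_indicator measurableSet_Ici, integral_Ici_eq_integral_Ioi,
    integral_exp_mul_Ioi (by linarith), mul_zero, Real.exp_zero, neg_div_neg_eq]

theorem measure_ge_expMeasure {x : ℝ} (hx : 0 ≤ x) :
    expMeasure 1 {y | x ≤ y} = ENNReal.ofReal (Real.exp (-x)) := by
  have := isProbabilityMeasure_expMeasure one_pos
  have hc := cdf_expMeasure_eq one_pos x
  rw [if_pos hx, cdf_eq_real, one_mul] at hc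
  have hna : expMeasure 1 {x} = 0 := by
    have h1 : expMeasure 1 = (volume : Measure ℝ).withDensity (exponentialPDF 1) := rfl
    rw [h1]
    exact withDensity_absolutelyContinuous _ _ (by simp)
  rw [show {y : ℝ | x ≤ y} = Ici x from rfl, ← measure_congr (Ioi_ae_eq_Ici' hna), ← compl_Iic,
    ← ofReal_measureReal, probReal_compl_eq_one_sub measurableSet_Iic, hc]
  congr 1; ring

theorem HasLaw.ae_pos_of_expMeasure {H : Ω → ℝ} (hH : HasLaw H (expMeasure 1) P) :
    ∀ᵐ ω ∂P, 0 < H ω := by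
  have := isProbabilityMeasure_expMeasure one_pos
  have hc := cdf_expMeasure_eq one_pos 0
  rw [if_pos le_rfl, cdf_eq_real] at hc
  have h1 : expMeasure 1 (Iic 0) = 0 := by
    rw [← ofReal_measureReal, hc]; simp
  have h2 := hH.measure_eq (p := fun y => y ≤ 0) measurableSet_Iic
  rw [ae_iff]
  simp only [not_lt]
  rw [h2]; exact h1

end Exponential

/-! ### Integrals over the plane of radial functions. -/

/-- The function `1 / (1 + t ^ p)` is integrable on the half-line if `1 < p`. -/
theorem integrableOn_one_div_one_add_rpow {p : ℝ} (hp : 1 < p) :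
    IntegrableOn (fun t : ℝ => 1 / (1 + t ^ p)) (Ioi 0) := by
  have hmeas : Measurable fun t : ℝ => 1 / (1 + t ^ p) := by fun_prop
  have h1 : IntegrableOn (fun t : ℝ => 1 / (1 + t ^ p)) (Ioc 0 1) := by
    refine Measure.integrableOn_of_bounded (M := 1) (by simp) hmeas.aestronglyMeasurable ?_
    refine (ae_restrict_iff' measurableSet_Ioc).2 (ae_of_all _ fun t ht => ?_)
    have : 0 ≤ t ^ p := Real.rpow_nonneg ht.1.le _
    rw [Real.norm_of_nonneg (by positivity), div_le_one (by positivity)]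
    linarith
  have h2 : IntegrableOn (fun t : ℝ => 1 / (1 + t ^ p)) (Ioi 1) := by
    refine (integrableOn_Ioi_rpow_of_lt (a := -p) (by linarith) one_pos).mono'
      hmeas.aestronglyMeasurable ?_
    refine (ae_restrict_iff' measurableSet_Ioi).2 (ae_of_all _ fun t ht => ?_)
    have ht0 : (0 : ℝ) < t := one_pos.trans ht
    have : 0 < t ^ p := Real.rpow_pos_of_pos ht0 _
    rw [Real.norm_of_nonneg (by positivity), Real.rpow_neg ht0.le, ← one_div]
    exact one_div_le_one_div_of_le this (by linarith)
  rw [← Ioc_union_Ioi_eq_Ioi zero_le_one]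
  exact h1.union h2

/-- Interference kernel of a transmitter at distance `y` for the Laplace variable `s`. -/
def interfKernel (α s y : ℝ) : ℝ := s * y ^ (-α) / (1 + s * y ^ (-α))

theorem interfKernel_nonneg {α s y : ℝ} (hs : 0 ≤ s) (hy : 0 ≤ y) : 0 ≤ interfKernel α s y := by
  have : 0 ≤ y ^ (-α) := Real.rpow_nonneg hy _
  unfold interfKernel; positivity

theorem measurable_interfKernel (α s : ℝ) : Measurable (interfKernel α s) := by
  unfold interfKernel; fun_prop

theorem interfKernel_eq {α s y : ℝ} (hα : 2 < α) (hs : 0 < s) (hy : 0 < y) :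
    interfKernel α s y = 1 / (1 + (s ^ (-(2 / α)) * y ^ (2 : ℝ)) ^ (α / 2)) := by
  have h0 : α ≠ 0 := by linarith
  have h1 : (s ^ (-(2 / α)) * y ^ (2 : ℝ)) ^ (α / 2) = s⁻¹ * y ^ α := by
    rw [Real.mul_rpow (by positivity) (by positivity), ← Real.rpow_mul hs.le, ← Real.rpow_mul hy.le,
      show -(2 / α) * (α / 2) = -1 by field_simp, Real.rpow_neg_one,
      show (2 : ℝ) * (α / 2) = α by ring]
  rw [h1, interfKernel, Real.rpow_neg hy.le]
  have : 0 < y ^ α := Real.rpow_pos_of_pos hy _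
  field_simp
  ring

/-- This is the substitution `t = s ^ (-(2 / α)) * y ^ 2`, which `interfKernel_eq` makes visible. -/
theorem integrableOn_mul_interfKernel {α s b : ℝ} (hα : 2 < α) (hs : 0 < s) (hb : 0 ≤ b) :
    IntegrableOn (fun y => y * interfKernel α s y) (Ioi b) ∧
      ∫ y in Ioi b, y * interfKernel α s y =
        s ^ (2 / α) / 2 * ∫ t in Ioi (s ^ (-(2 / α)) * b ^ 2), 1 / (1 + t ^ (α / 2)) := by
  set c := s ^ (-(2 / α)) with hc
  have hc0 : 0 < c := Real.rpow_pos_of_pos hs _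
  have hcinv : s ^ (2 / α) = c⁻¹ := by rw [hc, Real.rpow_neg hs.le, inv_inv]
  set g : ℝ → ℝ := fun t => 1 / (1 + t ^ (α / 2)) with hg
  have hint := integrableOn_one_div_one_add_rpow (p := α / 2) (by linarith)
  have hkey : ∀ y ∈ Ioi (0 : ℝ), ((2 : ℝ) * y ^ ((2 : ℝ) - 1)) • (g (c * y ^ (2 : ℝ))) =
      2 * (y * interfKernel α s y) := by
    intro y hy
    rw [interfKernel_eq hα hs hy, show (2 : ℝ) - 1 = 1 by norm_num, Real.rpow_one, smul_eq_mul]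
    ring
  have hgc : IntegrableOn (fun t => g (c * t)) (Ioi 0) := by
    have := (integrableOn_Ioi_comp_mul_left_iff g 0 hc0).2 (by rw [mul_zero]; exact hint)
    exact this
  constructor
  · have h1 := (integrableOn_Ioi_comp_rpow_iff (fun t => g (c * t)) (p := 2) (by norm_num)).2 hgc
    rw [abs_of_pos (by norm_num : (0 : ℝ) < 2)] at h1
    have h2 := h1.congr_fun hkey measurableSet_Ioi
    have h3 : IntegrableOn (fun y => y * interfKernel α s y) (Ioi 0) := by
      have := Integrable.const_mul h2 (1 / 2 : ℝ)
      refine this.congr (ae_of_all _ fun y => ?_)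
      simp
    exact h3.mono_set (Ioi_subset_Ioi hb)
  · have h1 := integral_comp_rpow_Ioi_of_pos' (g := fun t => g (c * t)) (p := 2) (by norm_num)
      (c := b ^ 2) (by positivity)
    have h2 : (b ^ 2 : ℝ) ^ ((2 : ℝ)⁻¹) = b := by
      rw [← Real.rpow_natCast, ← Real.rpow_mul hb]; norm_num
    rw [h2, integral_comp_mul_left_Ioi g (b ^ 2) hc0] at h1
    have h3 := setIntegral_congr_fun (μ := volume) (measurableSet_Ioi (a := b))
      (fun y hy => hkey y (hb.trans_lt hy))
    rw [h1, integral_const_mul] at h3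
    rw [hcinv]
    simp only [smul_eq_mul] at h3
    linarith

theorem integral_plane_norm (f : ℝ → ℝ) :
    ∫ x : Plane, f ‖x‖ = 2 * Real.pi * ∫ y in Ioi (0 : ℝ), y * f y := by
  rw [integral_fun_norm_addHaar]
  have : (volume : Measure Plane).real (Metric.ball 0 1) = Real.pi := by
    rw [measureReal_def, EuclideanSpace.volume_ball_fin_two]; simp [Real.pi_nonneg]
  simp [this]
  ring

theorem integrable_plane_norm {f : ℝ → ℝ} :
    Integrable (fun x : Plane => f ‖x‖) ↔ IntegrableOn (fun y => y * f y) (Ioi 0) := by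
  rw [integrable_fun_norm_addHaar]
  simp

theorem integral_plane_ball {a : ℝ} (ha : 0 ≤ a) :
    Integrable (fun x : Plane => (Iio a).indicator (1 : ℝ → ℝ) ‖x‖) ∧
      ∫ x : Plane, (Iio a).indicator (1 : ℝ → ℝ) ‖x‖ = Real.pi * a ^ 2 := by
  have h : (fun x : Plane => (Iio a).indicator (1 : ℝ → ℝ) ‖x‖) =
      (Metric.ball (0 : Plane) a).indicator 1 := by
    funext x; simp [indicator]
  rw [h]
  constructor
  · exact (integrable_indicator_iff Metric.isOpen_ball.measurableSet).2
      (integrableOn_const measure_ball_lt_top.ne)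
  · rw [integral_indicator_one Metric.isOpen_ball.measurableSet, measureReal_def,
      EuclideanSpace.volume_ball_fin_two]
    simp [Real.pi_nonneg, ha, mul_comm]

theorem integral_plane_interfKernel {α s b : ℝ} (hα : 2 < α) (hs : 0 ≤ s) (hb : 0 ≤ b) :
    Integrable (fun x : Plane => (Ioi b).indicator (interfKernel α s) ‖x‖) ∧
      ∫ x : Plane, (Ioi b).indicator (interfKernel α s) ‖x‖ =
        Real.pi * s ^ (2 / α) * ∫ t in Ioi (s ^ (-(2 / α)) * b ^ 2), 1 / (1 + t ^ (α / 2)) := by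
  -- The substitution needs `s > 0`; at `s = 0` the kernel and the factor `s ^ (2 / α)` both vanish.
  rcases hs.eq_or_lt with rfl | hs
  · have h0 : (2 / α) ≠ 0 := by have : 0 < α := by linarith
                                positivity
    have h1 : interfKernel α 0 = 0 := by funext y; simp [interfKernel]
    simp [h1, Real.zero_rpow h0]
  obtain ⟨h1, h2⟩ := integrableOn_mul_interfKernel hα hs hb
  have h3 : (fun y => y * (Ioi b).indicator (interfKernel α s) y) =
      (Ioi b).indicator (fun y => y * interfKernel α s y) := by
    funext y; by_cases hy : y ∈ Ioi b <;> simp [hy]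
  constructor
  · rw [integrable_plane_norm, h3]
    exact ((integrable_indicator_iff measurableSet_Ioi).2 h1).integrableOn
  · rw [integral_plane_norm, h3, setIntegral_indicator measurableSet_Ioi,
      inter_eq_right.2 (Ioi_subset_Ioi hb), h2]
    ring

/-! ### The density of the transmitters. -/

section Gamma

theorem upperGamma_zero_sub {s T : ℝ} (hs : 0 < s) (hT : 0 ≤ T) :
    D2DParams.upperGamma s 0 - D2DParams.upperGamma s T =
      ∫ t in (0 : ℝ)..T, t ^ (s - 1) * Real.exp (-t) := by
  have h := Real.GammaIntegral_convergent hs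
  have h' : IntegrableOn (fun t : ℝ => t ^ (s - 1) * Real.exp (-t)) (Ioi 0) := by
    simpa [mul_comm] using h
  exact intervalIntegral.integral_Ioi_sub_Ioi h' hT

theorem integral_rpow_mul_exp {κ T : ℝ} (hκ : 0 < κ) (hT : 0 ≤ T) :
    ∫ x in (0 : ℝ)..T, x ^ (2.5 : ℝ) * Real.exp (-(κ * x)) =
      κ ^ (-3.5 : ℝ) * (D2DParams.upperGamma 3.5 0 - D2DParams.upperGamma 3.5 (κ * T)) := by
  rw [upperGamma_zero_sub (by norm_num) (by positivity)]
  have h := intervalIntegral.integral_comp_mul_left (a := 0) (b := T)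
    (fun t : ℝ => t ^ ((3.5 : ℝ) - 1) * Real.exp (-t)) hκ.ne'
  rw [mul_zero, smul_eq_mul] at h
  have h2 : ∫ x in (0 : ℝ)..T, (κ * x) ^ ((3.5 : ℝ) - 1) * Real.exp (-(κ * x)) =
      κ ^ (2.5 : ℝ) * ∫ x in (0 : ℝ)..T, x ^ (2.5 : ℝ) * Real.exp (-(κ * x)) := by
    rw [← intervalIntegral.integral_const_mul]
    refine intervalIntegral.integral_congr fun x hx => ?_
    rw [uIcc_of_le hT] at hx
    rw [Real.mul_rpow hκ.le hx.1]; norm_num; ring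
  rw [h2] at h
  have h3 : κ ^ (-3.5 : ℝ) = κ⁻¹ * (κ ^ (2.5 : ℝ))⁻¹ := by
    rw [← Real.rpow_neg_one, ← Real.rpow_neg hκ.le, ← Real.rpow_add hκ]; norm_num
  have h4 : 0 < κ ^ (2.5 : ℝ) := Real.rpow_pos_of_pos hκ _
  rw [h3, mul_comm κ⁻¹, mul_assoc, ← h]
  field_simp

theorem D2DParams.pr_nonneg {N : ℕ} (D : D2DParams N) (i : Fin N) : 0 ≤ D.pr i := by
  unfold D2DParams.pr
  exact div_nonneg (Real.rpow_nonneg (by positivity) _)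
    (Finset.sum_nonneg fun k _ => Real.rpow_nonneg (by positivity) _)

theorem D2DParams.pr_pos {N : ℕ} (D : D2DParams N) (i : Fin N) : 0 < D.pr i := by
  unfold D2DParams.pr
  exact div_pos (Real.rpow_pos_of_pos (by positivity) _)
    (Finset.sum_pos (fun k _ => Real.rpow_pos_of_pos (by positivity) _) ⟨i, Finset.mem_univ i⟩)

/-- The density of the transmitters is that of the thinned process of caching users. -/
theorem D2DParams.lamDT_eq {N : ℕ} (D : D2DParams N) (i : Fin N) :
    D.lamDT i = D.lam * (D.pc i * (1 - D.silentProb i)) := by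
  -- If nobody caches file `i`, the quotients in `silentProb` and `theta` carry no meaning, but the
  -- factor `pc i = 0` removes them on both sides.
  rcases (D.pc_nonneg i).eq_or_lt with h0 | h0
  · simp [D2DParams.lamDT, D2DParams.lamFile, ← h0]
  have hl : 0 < D.lamFile i := mul_pos D.lam_pos h0
  have hT : 0 ≤ Real.pi * D.rc ^ 2 := by have := Real.pi_pos; positivity
  have hp : 0 ≤ D.lam * D.pr i := mul_nonneg D.lam_pos.le (D.pr_nonneg i)
  set l := D.lamFile i with hldef
  set q := D.lam * D.pr i with hq
  set K := (3.5 : ℝ) ^ (3.5 : ℝ) / Real.Gamma 3.5 * l ^ (3.5 : ℝ) with hK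
  have hK0 : 0 < K := by
    have : 0 < Real.Gamma 3.5 := Real.Gamma_pos_of_pos (by norm_num)
    positivity
  have hnum : (∫ x in (0 : ℝ)..Real.pi * D.rc ^ 2, Real.exp (-(q * x)) * D2DParams.cellDensity l x) =
      K * ((3.5 * l + q) ^ (-3.5 : ℝ) * (D2DParams.upperGamma 3.5 0 -
        D2DParams.upperGamma 3.5 ((3.5 * l + q) * (Real.pi * D.rc ^ 2)))) := by
    rw [← integral_rpow_mul_exp (by positivity) hT, ← intervalIntegral.integral_const_mul]
    refine intervalIntegral.integral_congr fun x _ => ?_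
    simp only [D2DParams.cellDensity]
    rw [← hK, show -((3.5 * l + q) * x) = -(q * x) + -3.5 * l * x by ring, Real.exp_add]
    ring
  have hden : (∫ x in (0 : ℝ)..Real.pi * D.rc ^ 2, D2DParams.cellDensity l x) =
      K * ((3.5 * l) ^ (-3.5 : ℝ) * (D2DParams.upperGamma 3.5 0 -
        D2DParams.upperGamma 3.5 ((3.5 * l) * (Real.pi * D.rc ^ 2)))) := by
    rw [← integral_rpow_mul_exp (by positivity) hT, ← intervalIntegral.integral_const_mul]
    refine intervalIntegral.integral_congr fun x _ => ?_
    simp only [D2DParams.cellDensity]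
    rw [← hK, show -((3.5 * l) * x) = -3.5 * l * x by ring]
    ring
  -- Numerator and denominator are truncated Gamma integrals with rates `3.5 * l + q` and `3.5 * l`;
  -- the normalization `K` cancels and the ratio of rates leaves the power `-3.5`.
  have hs : D.silentProb i = (1 + q / (3.5 * l)) ^ (-3.5 : ℝ) * D.theta i := by
    unfold D2DParams.silentProb D2DParams.theta
    rw [← hldef, ← hq, hnum, hden]
    have h1 : (1 + q / (3.5 * l)) ^ (-3.5 : ℝ) =
        (3.5 * l + q) ^ (-3.5 : ℝ) / (3.5 * l) ^ (-3.5 : ℝ) := by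
      rw [← Real.div_rpow (by positivity) (by positivity)]
      congr 1; field_simp
    have h2 : 0 < (3.5 * l) ^ (-3.5 : ℝ) := Real.rpow_pos_of_pos (by positivity) _
    rw [h1, mul_div_mul_left _ _ hK0.ne', mul_div_mul_comm]
    simp only [mul_assoc]
  rw [D2DParams.lamDT, ← hldef, ← hq, ← hs, hldef, D2DParams.lamFile]
  ring

end Gamma

/-! ### Mean effect of one user on the Laplace transform. -/

namespace D2DParams

variable {N : ℕ} (D : D2DParams N)

/-- Probability that a user caches file `i` and transmits. -/
def activeProb (i : Fin N) : ℝ := D.pc i * (1 - D.silentProb i)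

/-- Laplace exponent of the interference from outside the ball of radius `b` (for the users caching
file `i`) and from the whole plane (for the other users). -/
def interfExponent (i : Fin N) (b s : ℝ) : ℝ :=
  Real.pi * s ^ (2 / D.alpha) * (D.lamI * D.xi1 -
    D.lamDT i * ∫ t in (0 : ℝ)..s ^ (-(2 / D.alpha)) * b ^ 2, 1 / (1 + t ^ (D.alpha / 2)))

/-- Factor that a user at `x` with cache, activity and fading `m` contributes to the Laplace
transform of the interference on the event that no user caching file `i` is closer than `a`. -/
def markFactor (i : Fin N) (a b s : ℝ) (x : Plane) (m : Fin N × Bool × ℝ) : ℝ :=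
  (if m.1 = i ∧ ‖x‖ < a then 0 else 1) *
    Real.exp (-(s * if m.2.1 = true ∧ (m.1 = i → b < ‖x‖) then m.2.2 * ‖x‖ ^ (-D.alpha) else 0))

/-- One minus the mean of `markFactor`. -/
def thinning (i : Fin N) (a b s : ℝ) (x : Plane) : ℝ :=
  ∑ c, (D.pc c * (if c = i then (Iio a).indicator (1 : ℝ → ℝ) ‖x‖ else 0) +
    D.activeProb c * (Ioi (if c = i then b else 0)).indicator (interfKernel D.alpha s) ‖x‖)

theorem measurable_markFactor (i : Fin N) (a b s : ℝ) :
    Measurable (Function.uncurry (D.markFactor i a b s)) := by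
  unfold markFactor Function.uncurry
  refine Measurable.mul (Measurable.ite ?_ measurable_const measurable_const)
    (Real.measurable_exp.comp (Measurable.neg (Measurable.const_mul (Measurable.ite ?_ ?_
      measurable_const) _)))
  · exact ((measurableSet_singleton i).preimage (measurable_fst.comp measurable_snd)).inter
      (measurableSet_lt (measurable_norm.comp measurable_fst) measurable_const)
  · refine MeasurableSet.inter ((measurableSet_singleton true).preimage
      (measurable_fst.comp (measurable_snd.comp measurable_snd))) ?_
    have : {p : Plane × Fin N × Bool × ℝ | p.2.1 = i → b < ‖p.1‖} =
        {p | p.2.1 = i}ᶜ ∪ {p | b < ‖p.1‖} := by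
      ext p; simp [imp_iff_not_or]
    change MeasurableSet {p : Plane × Fin N × Bool × ℝ | p.2.1 = i → b < ‖p.1‖}
    rw [this]
    exact ((measurableSet_singleton i).preimage
      (measurable_fst.comp measurable_snd)).compl.union
      (measurableSet_lt measurable_const (measurable_norm.comp measurable_fst))
  · fun_prop

theorem measurable_thinning (i : Fin N) (a b s : ℝ) : Measurable (D.thinning i a b s) := by
  unfold thinning
  refine Finset.measurable_fun_sum _ fun c _ => Measurable.add (Measurable.const_mul ?_ _)
    (Measurable.const_mul ?_ _)
  · split_ifs
    · exact (measurable_one.indicator measurableSet_Iio).comp measurable_norm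
    · exact measurable_const
  · exact ((measurable_interfKernel _ _).indicator measurableSet_Ioi).comp measurable_norm

theorem lamDT_eq_mul_activeProb (i : Fin N) : D.lamDT i = D.lam * D.activeProb i := D.lamDT_eq i

/-- Mean number of thinned users. -/
theorem integral_thinning (i : Fin N) {a b s : ℝ} (ha : 0 ≤ a) (hb : 0 ≤ b) (hs : 0 ≤ s) :
    Integrable (D.thinning i a b s) ∧ D.lam * ∫ x, D.thinning i a b s x =
      D.lamFile i * Real.pi * a ^ 2 + D.interfExponent i b s := by
  obtain ⟨hi1, he1⟩ := integral_plane_ball ha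
  have hb' : ∀ c, 0 ≤ if c = i then b else 0 := fun c => by split_ifs <;> simp [hb]
  have h2 := fun c => integral_plane_interfKernel D.alpha_gt hs (hb' c)
  have hI1 : ∀ c, Integrable fun x : Plane =>
      D.pc c * (if c = i then (Iio a).indicator (1 : ℝ → ℝ) ‖x‖ else 0) := by
    intro c
    split_ifs
    · exact hi1.const_mul _
    · simp
  have hI2 := fun c => (h2 c).1.const_mul (D.activeProb c)
  have hI : ∀ c, Integrable fun x : Plane =>
      D.pc c * (if c = i then (Iio a).indicator (1 : ℝ → ℝ) ‖x‖ else 0) +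
      D.activeProb c * (Ioi (if c = i then b else 0)).indicator (interfKernel D.alpha s) ‖x‖ :=
    fun c => (hI1 c).add (hI2 c)
  refine ⟨integrable_finsetSum _ fun c _ => hI c, ?_⟩
  unfold thinning
  rw [integral_finsetSum _ fun c _ => hI c]
  -- Users caching other files interfere from the whole plane and give `xi1`; those caching file `i`
  -- give only the tail of that integral, written as `xi1` minus its initial piece.
  have hterm : ∀ c, ∫ x : Plane, (D.pc c * (if c = i then (Iio a).indicator (1 : ℝ → ℝ) ‖x‖ else 0) +
      D.activeProb c * (Ioi (if c = i then b else 0)).indicator (interfKernel D.alpha s) ‖x‖) =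
      (if c = i then D.pc c * (Real.pi * a ^ 2) else 0) + D.activeProb c * (Real.pi * s ^ (2 / D.alpha) *
        (D.xi1 - if c = i then ∫ t in (0 : ℝ)..s ^ (-(2 / D.alpha)) * b ^ 2,
          1 / (1 + t ^ (D.alpha / 2)) else 0)) := by
    intro c
    rw [integral_add (hI1 c) (hI2 c), integral_const_mul, integral_const_mul, (h2 c).2]
    have hint := integrableOn_one_div_one_add_rpow (p := D.alpha / 2)
      (by have := D.alpha_gt; linarith)
    congr 1
    · split_ifs
      · rw [he1]
      · simp
    · congr 2
      split_ifs
      · rw [xi1, ← intervalIntegral.integral_Ioi_sub_Ioi hint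
          (mul_nonneg (Real.rpow_nonneg hs _) (sq_nonneg b))]
        ring
      · simp [xi1]
  simp_rw [hterm]
  rw [Finset.sum_add_distrib, Finset.sum_ite_eq' Finset.univ i]
  simp only [Finset.mem_univ, if_true]
  have hsum : ∑ c, D.activeProb c * (Real.pi * s ^ (2 / D.alpha) *
        (D.xi1 - if c = i then ∫ t in (0 : ℝ)..s ^ (-(2 / D.alpha)) * b ^ 2,
          1 / (1 + t ^ (D.alpha / 2)) else 0)) =
      Real.pi * s ^ (2 / D.alpha) * ((∑ c, D.activeProb c) * D.xi1 -
        D.activeProb i * ∫ t in (0 : ℝ)..s ^ (-(2 / D.alpha)) * b ^ 2,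
          1 / (1 + t ^ (D.alpha / 2))) := by
    have hsplit : ∀ c, D.activeProb c * (Real.pi * s ^ (2 / D.alpha) *
        (D.xi1 - if c = i then ∫ t in (0 : ℝ)..s ^ (-(2 / D.alpha)) * b ^ 2,
          1 / (1 + t ^ (D.alpha / 2)) else 0)) =
        Real.pi * s ^ (2 / D.alpha) * (D.activeProb c * D.xi1) -
        Real.pi * s ^ (2 / D.alpha) * (if c = i then D.activeProb c *
          ∫ t in (0 : ℝ)..s ^ (-(2 / D.alpha)) * b ^ 2, 1 / (1 + t ^ (D.alpha / 2)) else 0) := by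
      intro c
      split_ifs <;> ring
    simp_rw [hsplit]
    rw [Finset.sum_sub_distrib, ← Finset.mul_sum, ← Finset.mul_sum, ← Finset.sum_mul,
      Finset.sum_ite_eq' Finset.univ i]
    simp only [Finset.mem_univ, if_true]
    ring
  rw [hsum, interfExponent, lamI]
  simp_rw [lamDT_eq_mul_activeProb]
  rw [← Finset.mul_sum, lamFile]
  ring

namespace IsNetwork

variable {D} {Ω : Type*} [MeasurableSpace Ω] {P : Measure Ω} {X : ℕ → Ω → Plane}
  {C : ℕ → Ω → Fin N} {A : ℕ → Ω → Bool} {H : ℕ → Ω → ℝ} {J : Ω → Fin N} {G : Ω → ℝ}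

theorem activeProb_nonneg (h : D.IsNetwork P X C A H J G) (i : Fin N) : 0 ≤ D.activeProb i := by
  rw [activeProb, ← h.law_active 0 i]; exact measureReal_nonneg

theorem ae_fading_pos (h : D.IsNetwork P X C A H J G) : ∀ᵐ ω ∂P, ∀ j, 0 < H j ω :=
  ae_all_iff.2 fun j => HasLaw.ae_pos_of_expMeasure (h.law_fading j)

theorem indep_positions_marks (h : D.IsNetwork P X C A H J G) :
    IndepFun (fun ω (j : ℕ) => X j ω) (fun ω (j : ℕ) => (C j ω, A j ω, H j ω)) P :=
  h.indep_positions.comp measurable_id measurable_fst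

theorem thinning_nonneg (h : D.IsNetwork P X C A H J G) (i : Fin N) {a b s : ℝ} (hs : 0 ≤ s)
    (x : Plane) : 0 ≤ D.thinning i a b s x := by
  unfold thinning
  refine Finset.sum_nonneg fun c _ => add_nonneg (mul_nonneg (D.pc_nonneg c) ?_)
    (mul_nonneg (h.activeProb_nonneg c) ?_)
  · split_ifs
    · exact indicator_nonneg (by simp) _
    · exact le_rfl
  · by_cases hx : ‖x‖ ∈ Ioi (if c = i then b else 0)
    · rw [indicator_of_mem hx]; exact interfKernel_nonneg hs (norm_nonneg x)
    · rw [indicator_of_notMem hx]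

theorem markFactor_nonneg (i : Fin N) (a b s : ℝ) (x : Plane) (m : Fin N × Bool × ℝ) :
    0 ≤ D.markFactor i a b s x m := by
  unfold markFactor
  split_ifs <;> simp [Real.exp_nonneg]

variable [IsProbabilityMeasure P]

/-- The gain is independent of cache and activity, and `1 - E exp (-u H) = u / (1 + u)`; this is the
origin of `interfKernel`. -/
theorem integral_active_exp (h : D.IsNetwork P X C A H J G) (j : ℕ) (c : Fin N) {u : ℝ}
    (hu : 0 ≤ u) :
    Integrable (fun ω => {ω | C j ω = c ∧ A j ω = true}.indicator (1 : Ω → ℝ) ω *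
        (1 - Real.exp (-(u * H j ω)))) P ∧
    ∫ ω, {ω | C j ω = c ∧ A j ω = true}.indicator (1 : Ω → ℝ) ω *
        (1 - Real.exp (-(u * H j ω))) ∂P = D.activeProb c * (u / (1 + u)) := by
  have hS : MeasurableSet {ω | C j ω = c ∧ A j ω = true} :=
    ((measurableSet_singleton c).preimage (h.measurable_cache j)).inter
      ((measurableSet_singleton true).preimage (h.measurable_active j))
  have hH := h.measurable_fading j
  have hi2 : Integrable (fun ω => Real.exp (-(u * H j ω))) P := by
    refine Integrable.of_bound (C := 1) (by fun_prop) ?_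
    filter_upwards [h.ae_fading_pos] with ω hω
    rw [Real.norm_of_nonneg (Real.exp_nonneg _), Real.exp_le_one_iff]
    have := mul_nonneg hu (hω j).le
    linarith
  have hi3 : Integrable (fun ω => 1 - Real.exp (-(u * H j ω))) P := (integrable_const 1).sub hi2
  have hfun : (fun ω => {ω | C j ω = c ∧ A j ω = true}.indicator (1 : Ω → ℝ) ω) =
      (fun p : Fin N × Bool => if p = (c, true) then (1 : ℝ) else 0) ∘
        fun ω => (C j ω, A j ω) := by
    funext ω
    simp [indicator, Prod.ext_iff]
  have hind : IndepFun (fun ω => {ω | C j ω = c ∧ A j ω = true}.indicator (1 : Ω → ℝ) ω)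
      (fun ω => 1 - Real.exp (-(u * H j ω))) P := by
    rw [hfun]
    exact (h.indep_fading j).comp (ψ := fun y => 1 - Real.exp (-(u * y)))
      (measurable_of_countable _) (by fun_prop)
  have hi1 : Integrable (fun ω => {ω | C j ω = c ∧ A j ω = true}.indicator (1 : Ω → ℝ) ω) P :=
    (integrable_const (1 : ℝ)).indicator hS
  refine ⟨hind.integrable_mul hi1 hi3, ?_⟩
  rw [hind.integral_fun_mul_eq_mul_integral hi1.aestronglyMeasurable hi3.aestronglyMeasurable,
    integral_indicator_one hS, h.law_active, ← activeProb, integral_sub (integrable_const 1) hi2]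
  have : ∫ ω, Real.exp (-(u * H j ω)) ∂P = 1 / (1 + u) := by
    rw [← integral_exp_neg_mul_expMeasure hu, ← (h.law_fading j).map_eq,
      integral_map hH.aemeasurable (by fun_prop)]
  rw [this]
  have h1u : 1 - 1 / (1 + u) = u / (1 + u) := by
    have : 1 + u ≠ 0 := by linarith
    field_simp
    ring
  simp [← h1u]

/-- A user of file `i` cannot both violate the void condition `‖x‖ < a` and interfere from beyond
`b`, because `a ≤ b`. Hence one minus the factor is a plain sum over files of a void term and an
interference term. -/
theorem integral_markFactor (h : D.IsNetwork P X C A H J G) (i : Fin N) {a b s : ℝ}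
    (hab : a ≤ b) (hs : 0 ≤ s) (j : ℕ) (x : Plane) :
    Integrable (fun ω => D.markFactor i a b s x (C j ω, A j ω, H j ω)) P ∧
    ∫ ω, D.markFactor i a b s x (C j ω, A j ω, H j ω) ∂P = 1 - D.thinning i a b s x := by
  have hα : D.alpha ≠ 0 := by have := D.alpha_gt; linarith
  set u := s * ‖x‖ ^ (-D.alpha) with hu
  have hu0 : 0 ≤ u := mul_nonneg hs (Real.rpow_nonneg (norm_nonneg _) _)
  set g1 : Fin N → ℝ := fun c => if c = i then (Iio a).indicator (1 : ℝ → ℝ) ‖x‖ else 0 with hg1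
  set g2 : Fin N → ℝ := fun c => if c = i → b < ‖x‖ then 1 else 0 with hg2
  have hcS : ∀ c, MeasurableSet {ω | C j ω = c} := fun c =>
    (measurableSet_singleton c).preimage (h.measurable_cache j)
  have hpt : ∀ ω, D.markFactor i a b s x (C j ω, A j ω, H j ω) =
      1 - ∑ c, ({ω | C j ω = c}.indicator (1 : Ω → ℝ) ω * g1 c +
        {ω | C j ω = c ∧ A j ω = true}.indicator (1 : Ω → ℝ) ω *
          (1 - Real.exp (-(u * H j ω))) * g2 c) := by
    intro ω
    rw [Finset.sum_eq_single (C j ω)]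
    · simp only [markFactor, hg1, hg2, indicator, mem_ofPred_eq, mem_Iio, Pi.one_apply, if_true,
        true_and, one_mul]
      by_cases hA : A j ω = true
      · by_cases hc : C j ω = i
        · by_cases hxa : ‖x‖ < a
          · have : ¬ b < ‖x‖ := by linarith
            simp [hc, hxa, this]
          · by_cases hxb : b < ‖x‖
            · simp only [hc, hxa, hA, hxb, hu]; simp; ring
            · simp [hc, hxa, hA, hxb]
        · simp only [hc, hA, hu]; simp; ring
      · by_cases hc : C j ω = i
        · by_cases hxa : ‖x‖ < a <;> simp [hc, hxa, hA]
        · simp [hc, hA]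
    · intro c _ hc
      simp [indicator, hc.symm]
    · simp
  have hi1 : ∀ c, Integrable (fun ω => {ω | C j ω = c}.indicator (1 : Ω → ℝ) ω * g1 c) P :=
    fun c => ((integrable_const (1 : ℝ)).indicator (hcS c)).mul_const _
  have hi2 := fun c => ((h.integral_active_exp j c hu0).1.mul_const (g2 c))
  have hi12 : ∀ c, Integrable (fun ω => {ω | C j ω = c}.indicator (1 : Ω → ℝ) ω * g1 c +
        {ω | C j ω = c ∧ A j ω = true}.indicator (1 : Ω → ℝ) ω *
          (1 - Real.exp (-(u * H j ω))) * g2 c) P := fun c => (hi1 c).add (hi2 c)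
  have hi : Integrable (fun ω => ∑ c, ({ω | C j ω = c}.indicator (1 : Ω → ℝ) ω * g1 c +
        {ω | C j ω = c ∧ A j ω = true}.indicator (1 : Ω → ℝ) ω *
          (1 - Real.exp (-(u * H j ω))) * g2 c)) P :=
    integrable_finsetSum _ fun c _ => hi12 c
  simp_rw [hpt]
  refine ⟨(integrable_const 1).sub hi, ?_⟩
  rw [integral_sub (integrable_const 1) hi, integral_finsetSum _ fun c _ => hi12 c]
  simp only [integral_const, probReal_univ, smul_eq_mul, mul_one]
  congr 1
  unfold thinning
  refine Finset.sum_congr rfl fun c _ => ?_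
  rw [integral_add (hi1 c) (hi2 c), integral_mul_const, integral_mul_const,
    (h.integral_active_exp j c hu0).2, integral_indicator_one (hcS c), h.law_cache]
  congr 1
  rw [mul_assoc]
  congr 1
  simp only [hg2, interfKernel, indicator, mem_Ioi, hu]
  by_cases hc : c = i
  · by_cases hxb : b < ‖x‖ <;> simp [hc, hxb]
  -- The indicator of `Ioi 0` drops the origin, which is harmless: `0 ^ (-α) = 0` by convention, so
  -- the kernel vanishes there too.
  · rcases (norm_nonneg x).eq_or_lt with h0 | h0
    · simp [hc, ← h0, Real.zero_rpow (neg_ne_zero.2 hα)]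
    · simp [hc, norm_pos_iff.1 h0]

/-- One minus `thinning` is the mean of a nonnegative variable. -/
theorem thinning_le_one (h : D.IsNetwork P X C A H J G) (i : Fin N) {a b s : ℝ} (hab : a ≤ b)
    (hs : 0 ≤ s) (x : Plane) : D.thinning i a b s x ≤ 1 := by
  have := (h.integral_markFactor i hab hs 0 x).2
  have h2 : 0 ≤ ∫ ω, D.markFactor i a b s x (C 0 ω, A 0 ω, H 0 ω) ∂P :=
    integral_nonneg fun ω => markFactor_nonneg i a b s x _
  linarith

/-- Laplace transform of the interference on the event that no user caching file `i` is closer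
than `a`, as a limit of finite products. -/
theorem lintegral_prod_markFactor (h : D.IsNetwork P X C A H J G) (i : Fin N) {a b s : ℝ}
    (ha : 0 ≤ a) (hab : a ≤ b) (hs : 0 ≤ s) {L : Ω → ℝ≥0∞}
    (hL : ∀ᵐ ω ∂P, Tendsto (fun n => ∏ j ∈ Finset.range n, ENNReal.ofReal
      (D.markFactor i a b s (X j ω) (C j ω, A j ω, H j ω))) atTop (𝓝 (L ω))) :
    ∫⁻ ω, L ω ∂P = ENNReal.ofReal
      (Real.exp (-(D.lamFile i * Real.pi * a ^ 2 + D.interfExponent i b s))) := by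
  obtain ⟨hint, hval⟩ := D.integral_thinning i ha (ha.trans hab) hs
  have hnn : ∀ x, 0 ≤ D.thinning i a b s x := h.thinning_nonneg i hs
  have hlint : ∫⁻ x, ENNReal.ofReal (D.thinning i a b s x)
      ∂(ENNReal.ofReal D.lam • (volume : Measure Plane)) =
      ENNReal.ofReal (D.lamFile i * Real.pi * a ^ 2 + D.interfExponent i b s) := by
    rw [lintegral_smul_measure, ← ofReal_integral_eq_lintegral_ofReal hint (ae_of_all _ hnn),
      smul_eq_mul, ← ENNReal.ofReal_mul D.lam_pos.le, hval]
  have h0 : 0 ≤ D.lamFile i * Real.pi * a ^ 2 + D.interfExponent i b s := by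
    rw [← hval]; exact mul_nonneg D.lam_pos.le (integral_nonneg hnn)
  have := h.users.lintegral_marked_prod (m := fun j ω => (C j ω, A j ω, H j ω))
    (w := fun x m => ENNReal.ofReal (D.markFactor i a b s x m))
    (v := fun x => ENNReal.ofReal (D.thinning i a b s x)) (L := L)
    (fun j => (h.measurable_cache j).prodMk ((h.measurable_active j).prodMk (h.measurable_fading j)))
    h.indep_positions_marks h.indep_users (D.measurable_markFactor i a b s).ennreal_ofReal
    (D.measurable_thinning i a b s).ennreal_ofReal
    (fun x => by simpa using h.thinning_le_one i hab hs x) (by rw [hlint]; simp)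
    (fun j x => by
      obtain ⟨h1, h2⟩ := h.integral_markFactor i hab hs j x
      rw [← ofReal_integral_eq_lintegral_ofReal h1 (ae_of_all _ fun ω => markFactor_nonneg _ _ _ _ _ _),
        h2, ENNReal.ofReal_sub _ (hnn x), ENNReal.ofReal_one])
    (by
      filter_upwards [h.ae_fading_pos] with ω hω j
      refine ENNReal.ofReal_le_one.2 ?_
      unfold markFactor
      refine mul_le_one₀ (by split_ifs <;> simp) (Real.exp_nonneg _) (Real.exp_le_one_iff.2 ?_)
      refine neg_nonpos.2 (mul_nonneg hs ?_)
      split_ifs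
      · exact mul_nonneg (hω j).le (Real.rpow_nonneg (norm_nonneg _) _)
      · exact le_rfl)
    hL
  rw [this, hlint, ENNReal.toReal_ofReal h0]

end IsNetwork

end D2DParams

/-! ### Convergence and Laplace transform of the interference. -/

namespace D2DParams

variable {N : ℕ} (D : D2DParams N)

section Measurability

variable {Ω : Type*} [MeasurableSpace Ω] {X : ℕ → Ω → Plane}
  {C : ℕ → Ω → Fin N} {A : ℕ → Ω → Bool} {H : ℕ → Ω → ℝ}

theorem measurable_nearest (hX : ∀ j, Measurable (X j)) (hC : ∀ j, Measurable (C j)) (i : Fin N) :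
    Measurable (nearest X C i) := by
  classical
  unfold nearest
  refine Measurable.iInf fun j => ?_
  simp_rw [iInf_eq_if]
  exact Measurable.ite ((measurableSet_singleton i).preimage (hC j)) (hX j).enorm measurable_const

theorem measurable_interferenceTerm (hX : ∀ j, Measurable (X j)) (hC : ∀ j, Measurable (C j))
    (hA : ∀ j, Measurable (A j)) (hH : ∀ j, Measurable (H j)) (i : Fin N) {R : Ω → ℝ}
    (hR : Measurable R) (j : ℕ) :
    Measurable fun ω => D.interferenceTerm X C A H i (R ω) ω j := by
  unfold interferenceTerm
  refine Measurable.ite ?_ ((hH j).mul ((hX j).norm.pow_const _)) measurable_const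
  refine ((measurableSet_singleton true).preimage (hA j)).inter ?_
  have : {ω | C j ω = i → R ω < ‖X j ω‖} = {ω | C j ω = i}ᶜ ∪ {ω | R ω < ‖X j ω‖} := by
    ext ω; simp [imp_iff_not_or]
  change MeasurableSet {ω | C j ω = i → R ω < ‖X j ω‖}
  rw [this]
  exact ((measurableSet_singleton i).preimage (hC j)).compl.union
    (measurableSet_lt hR (hX j).norm)

theorem ofReal_le_nearest_iff {i : Fin N} {a : ℝ} {ω : Ω} :
    ENNReal.ofReal a ≤ nearest X C i ω ↔ ∀ j, C j ω = i → a ≤ ‖X j ω‖ := by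
  unfold nearest
  simp only [le_iInf_iff]
  refine forall₂_congr fun j _ => ?_
  rw [← ofReal_norm, ENNReal.ofReal_le_ofReal_iff (norm_nonneg _)]

theorem nearest_toReal_lt_iff {i : Fin N} {ω : Ω} (hfin : nearest X C i ω ≠ ∞) {y : ℝ} :
    (nearest X C i ω).toReal < y ↔ ∃ j, C j ω = i ∧ ‖X j ω‖ < y := by
  rw [← not_iff_not, not_lt, ← ENNReal.ofReal_le_iff_le_toReal hfin, ofReal_le_nearest_iff]
  push Not
  rfl

/-- The interference seen from a receiver of file `i` served at distance `r`. -/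
def interference (X : ℕ → Ω → Plane) (C : ℕ → Ω → Fin N) (A : ℕ → Ω → Bool) (H : ℕ → Ω → ℝ)
    (i : Fin N) (r : ℝ) (ω : Ω) : ℝ :=
  ∑' j, D.interferenceTerm X C A H i r ω j

/-- Interference plus noise over path gain on the link to the nearest user caching file `i`. -/
def linkLoad (X : ℕ → Ω → Plane) (C : ℕ → Ω → Fin N) (A : ℕ → Ω → Bool) (H : ℕ → Ω → ℝ)
    (i : Fin N) (ω : Ω) : ℝ :=
  (nearest X C i ω).toReal ^ D.alpha *
    (D.interference X C A H i (nearest X C i ω).toReal ω + D.sigma2 / D.Pt)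

theorem measurable_interference (hX : ∀ j, Measurable (X j)) (hC : ∀ j, Measurable (C j))
    (hA : ∀ j, Measurable (A j)) (hH : ∀ j, Measurable (H j)) (i : Fin N) {R : Ω → ℝ}
    (hR : Measurable R) : Measurable fun ω => D.interference X C A H i (R ω) ω :=
  Measurable.tsum fun j => D.measurable_interferenceTerm hX hC hA hH i hR j

theorem measurable_linkLoad (hX : ∀ j, Measurable (X j)) (hC : ∀ j, Measurable (C j))
    (hA : ∀ j, Measurable (A j)) (hH : ∀ j, Measurable (H j)) (i : Fin N) :
    Measurable (D.linkLoad X C A H i) := by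
  have hR := (measurable_nearest hX hC i).ennreal_toReal
  exact (hR.pow_const _).mul ((D.measurable_interference hX hC hA hH i hR).add_const _)

end Measurability

namespace IsNetwork

variable {D} {Ω : Type*} [MeasurableSpace Ω] {P : Measure Ω} {X : ℕ → Ω → Plane}
  {C : ℕ → Ω → Fin N} {A : ℕ → Ω → Bool} {H : ℕ → Ω → ℝ} {J : Ω → Fin N} {G : Ω → ℝ}

theorem interferenceTerm_nonneg {ω : Ω} (hω : ∀ j, 0 < H j ω) (i : Fin N) (r : ℝ) (j : ℕ) :
    0 ≤ D.interferenceTerm X C A H i r ω j := by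
  unfold interferenceTerm
  split_ifs
  · exact mul_nonneg (hω j).le (Real.rpow_nonneg (norm_nonneg _) _)
  · exact le_rfl

theorem interferenceTerm_anti {ω : Ω} (hω : ∀ j, 0 < H j ω) (i : Fin N) {r r' : ℝ} (hr : r ≤ r')
    (j : ℕ) : D.interferenceTerm X C A H i r' ω j ≤ D.interferenceTerm X C A H i r ω j := by
  by_cases h : A j ω = true ∧ (C j ω = i → r' < ‖X j ω‖)
  · have h' : A j ω = true ∧ (C j ω = i → r < ‖X j ω‖) := ⟨h.1, fun hc => hr.trans_lt (h.2 hc)⟩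
    rw [interferenceTerm, interferenceTerm, if_pos h, if_pos h']
  · conv_lhs => rw [interferenceTerm, if_neg h]
    exact interferenceTerm_nonneg hω i r j

/-- Radius `0` dominates even negative radii: these can only add users of file `i` at the origin,
whose term is `0` since `0 ^ (-α) = 0`. -/
theorem interferenceTerm_le_zero_radius {ω : Ω} (hω : ∀ j, 0 < H j ω) (i : Fin N) (r : ℝ)
    (j : ℕ) : D.interferenceTerm X C A H i r ω j ≤ D.interferenceTerm X C A H i 0 ω j := by
  have hα : D.alpha ≠ 0 := by have := D.alpha_gt; linarith
  rcases (norm_nonneg (X j ω)).eq_or_lt with h0 | h0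
  · refine le_trans (le_of_eq ?_) (interferenceTerm_nonneg hω i 0 j)
    unfold interferenceTerm
    rw [← h0, Real.zero_rpow (neg_ne_zero.2 hα), mul_zero, ite_self]
  · by_cases hA : A j ω = true
    · have h' : A j ω = true ∧ (C j ω = i → 0 < ‖X j ω‖) := ⟨hA, fun _ => h0⟩
      conv_rhs => rw [interferenceTerm, if_pos h']
      unfold interferenceTerm
      split_ifs
      · exact le_rfl
      · exact mul_nonneg (hω j).le (Real.rpow_nonneg (norm_nonneg _) _)
    · simp [interferenceTerm, hA]

theorem prod_markFactor (i : Fin N) (a b s : ℝ) (ω : Ω) (n : ℕ) :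
    ∏ j ∈ Finset.range n, D.markFactor i a b s (X j ω) (C j ω, A j ω, H j ω) =
      (∏ j ∈ Finset.range n, if C j ω = i ∧ ‖X j ω‖ < a then (0 : ℝ) else 1) *
        Real.exp (-(s * ∑ j ∈ Finset.range n, D.interferenceTerm X C A H i b ω j)) := by
  rw [Finset.mul_sum, ← Finset.sum_neg_distrib, Real.exp_sum, ← Finset.prod_mul_distrib]
  rfl

variable [IsProbabilityMeasure P]

/-- Let `Z s` be the infimum of `exp (-s S_n)` over the partial sums `S_n`. It is at most `1` and
vanishes where the series diverges, so divergence has probability at most `1 - E (Z s)`. The Laplace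
functional computes this bound without presupposing convergence, and it tends to `0` as `s → 0`. -/
theorem ae_summable_zero_radius (h : D.IsNetwork P X C A H J G) (i : Fin N) :
    ∀ᵐ ω ∂P, Summable (D.interferenceTerm X C A H i 0 ω) := by
  set Z : ℝ → Ω → ℝ≥0∞ := fun s ω => ⨅ n, ∏ j ∈ Finset.range n,
    ENNReal.ofReal (D.markFactor i 0 0 s (X j ω) (C j ω, A j ω, H j ω)) with hZ
  have hprod : ∀ s ω n, ∏ j ∈ Finset.range n,
      ENNReal.ofReal (D.markFactor i 0 0 s (X j ω) (C j ω, A j ω, H j ω)) =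
      ENNReal.ofReal (Real.exp
        (-(s * ∑ j ∈ Finset.range n, D.interferenceTerm X C A H i 0 ω j))) := by
    intro s ω n
    rw [← ENNReal.ofReal_prod_of_nonneg fun j _ => markFactor_nonneg _ _ _ _ _ _, prod_markFactor]
    simp [not_lt.2 (norm_nonneg _)]
  have hZint : ∀ s, 0 < s → ∫⁻ ω, Z s ω ∂P =
      ENNReal.ofReal (Real.exp (-(Real.pi * s ^ (2 / D.alpha) * (D.lamI * D.xi1)))) := by
    intro s hs
    rw [h.lintegral_prod_markFactor i le_rfl le_rfl hs.le (L := Z s)]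
    · simp [interfExponent]
    · filter_upwards [h.ae_fading_pos] with ω hω
      refine tendsto_atTop_iInf fun m n hmn => ?_
      simp only [hprod]
      refine ENNReal.ofReal_le_ofReal (Real.exp_le_exp.2 (neg_le_neg (mul_le_mul_of_nonneg_left ?_
        hs.le)))
      exact Finset.sum_le_sum_of_subset_of_nonneg (Finset.range_mono hmn)
        fun j _ _ => interferenceTerm_nonneg hω i 0 j
  have hZ0 : ∀ s, 0 < s → ∀ ω, (∀ j, 0 < H j ω) →
      ¬ Summable (D.interferenceTerm X C A H i 0 ω) → Z s ω = 0 := by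
    intro s hs ω hω hns
    by_contra hne
    refine hns ?_
    have hfin : Z s ω ≠ ∞ := by
      refine ne_top_of_le_ne_top ENNReal.one_ne_top ((iInf_le _ 0).trans ?_)
      simp
    -- If `Z s > 0`, then `Z s ≤ exp (-s S_n)` bounds every partial sum by `-log (Z s) / s`.
    refine summable_of_sum_range_le (c := -Real.log (Z s ω).toReal / s)
      (fun j => interferenceTerm_nonneg hω i 0 j) fun n => ?_
    have h1 : Z s ω ≤ _ := (iInf_le _ n).trans (hprod s ω n).le
    have h2 := ENNReal.toReal_le_of_le_ofReal (Real.exp_nonneg _) h1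
    have h3 : 0 < (Z s ω).toReal := ENNReal.toReal_pos hne hfin
    have h4 := (Real.log_le_iff_le_exp h3).2 h2
    rw [le_div_iff₀ hs]
    linarith
  have hmeasZ : ∀ s, Measurable (Z s) := by
    intro s
    refine Measurable.iInf fun n => ?_
    simp only [hprod]
    have := fun j => D.measurable_interferenceTerm h.users.measurable_point h.measurable_cache
      h.measurable_active h.measurable_fading i (R := fun _ => 0) measurable_const j
    fun_prop
  have hbound : ∀ s, 0 < s → P {ω | ¬ Summable (D.interferenceTerm X C A H i 0 ω)} ≤
      1 - ENNReal.ofReal (Real.exp (-(Real.pi * s ^ (2 / D.alpha) * (D.lamI * D.xi1)))) := by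
    intro s hs
    have hS : MeasurableSet {ω | Z s ω = 0} := (measurableSet_singleton 0).preimage (hmeasZ s)
    have h1 : P {ω | ¬ Summable (D.interferenceTerm X C A H i 0 ω)} ≤ P {ω | Z s ω = 0} := by
      refine measure_mono_ae ?_
      filter_upwards [h.ae_fading_pos] with ω hω hns using hZ0 s hs ω hω hns
    refine h1.trans ?_
    rw [← hZint s hs, ← compl_compl {ω | Z s ω = 0}, prob_compl_eq_one_sub hS.compl]
    refine tsub_le_tsub_left ?_ _
    rw [← lintegral_indicator_one hS.compl]
    refine lintegral_mono fun ω => ?_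
    by_cases h0 : Z s ω = 0
    · simp [h0]
    · rw [indicator_of_mem (by simpa using h0)]
      refine (iInf_le _ 0).trans ?_
      simp
  have hlim : Tendsto (fun s : ℝ => 1 - ENNReal.ofReal (Real.exp
      (-(Real.pi * s ^ (2 / D.alpha) * (D.lamI * D.xi1))))) (𝓝[>] 0) (𝓝 0) := by
    have hα : 0 < 2 / D.alpha := by have := D.alpha_gt; positivity
    have hc : Continuous fun s : ℝ => Real.exp
        (-(Real.pi * s ^ (2 / D.alpha) * (D.lamI * D.xi1))) := by
      have := Real.continuous_rpow_const hα.le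
      fun_prop
    have h1 := (ENNReal.tendsto_ofReal (hc.tendsto 0)).mono_left (nhdsWithin_le_nhds (s := Ioi 0))
    have h2 := ENNReal.Tendsto.sub (tendsto_const_nhds (x := (1 : ℝ≥0∞))) h1
      (Or.inl ENNReal.one_ne_top)
    simpa [Real.zero_rpow hα.ne'] using h2
  refine le_antisymm (ge_of_tendsto hlim ?_) bot_le
  filter_upwards [self_mem_nhdsWithin] with s hs using hbound s hs

/-- Almost surely, the interference is a convergent series. -/
theorem ae_summable (h : D.IsNetwork P X C A H J G) :
    ∀ᵐ ω ∂P, ∀ (i : Fin N) (r : ℝ), Summable (D.interferenceTerm X C A H i r ω) := by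
  filter_upwards [ae_all_iff.2 h.ae_summable_zero_radius, h.ae_fading_pos] with ω hs hω i r
  exact Summable.of_nonneg_of_le (fun j => interferenceTerm_nonneg hω i r j)
    (fun j => interferenceTerm_le_zero_radius hω i r j) (hs i)

/-- The product of the mark factors tends to the integrand: either every void factor is `1` and the
exponentials converge with the series, or some user is too close and the product is `0` from its
index on. -/
theorem integral_exp_interference (h : D.IsNetwork P X C A H J G) (i : Fin N) {a b s : ℝ}
    (ha : 0 ≤ a) (hab : a ≤ b) (hs : 0 ≤ s) :
    Integrable ({ω | ENNReal.ofReal a ≤ nearest X C i ω}.indicator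
        fun ω => Real.exp (-(s * D.interference X C A H i b ω))) P ∧
    ∫ ω, {ω | ENNReal.ofReal a ≤ nearest X C i ω}.indicator
        (fun ω => Real.exp (-(s * D.interference X C A H i b ω))) ω ∂P =
      Real.exp (-(D.lamFile i * Real.pi * a ^ 2 + D.interfExponent i b s)) := by
  classical
  have hmS : MeasurableSet {ω | ENNReal.ofReal a ≤ nearest X C i ω} :=
    measurableSet_le measurable_const (measurable_nearest h.users.measurable_point
      h.measurable_cache i)
  have hmI := D.measurable_interference h.users.measurable_point h.measurable_cache
      h.measurable_active h.measurable_fading i (R := fun _ => b) measurable_const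
  have hme : Measurable ({ω | ENNReal.ofReal a ≤ nearest X C i ω}.indicator
      fun ω => Real.exp (-(s * D.interference X C A H i b ω))) :=
    Measurable.indicator (by fun_prop) hmS
  have hnn : ∀ ω, 0 ≤ {ω | ENNReal.ofReal a ≤ nearest X C i ω}.indicator
      (fun ω => Real.exp (-(s * D.interference X C A H i b ω))) ω :=
    fun ω => indicator_nonneg (fun _ _ => Real.exp_nonneg _) _
  constructor
  · refine Integrable.of_bound (C := 1) hme.aestronglyMeasurable ?_
    filter_upwards [h.ae_fading_pos] with ω hω
    rw [Real.norm_of_nonneg (hnn ω)]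
    by_cases hmem : ω ∈ {ω | ENNReal.ofReal a ≤ nearest X C i ω}
    · rw [indicator_of_mem hmem]
      exact Real.exp_le_one_iff.2 (neg_nonpos.2 (mul_nonneg hs (tsum_nonneg fun j =>
        interferenceTerm_nonneg hω i b j)))
    · rw [indicator_of_notMem hmem]; exact zero_le_one
  · rw [integral_eq_lintegral_of_nonneg_ae (ae_of_all _ hnn) hme.aestronglyMeasurable,
      h.lintegral_prod_markFactor i ha hab hs, ENNReal.toReal_ofReal (Real.exp_nonneg _)]
    filter_upwards [h.ae_summable] with ω hsum
    simp_rw [← fun n => ENNReal.ofReal_prod_of_nonneg (s := Finset.range n)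
      (f := fun j => D.markFactor i a b s (X j ω) (C j ω, A j ω, H j ω))
      fun j _ => markFactor_nonneg _ _ _ _ _ _, prod_markFactor]
    refine ENNReal.tendsto_ofReal ?_
    have hexp : Tendsto (fun n => Real.exp (-(s * ∑ j ∈ Finset.range n,
        D.interferenceTerm X C A H i b ω j))) atTop
        (𝓝 (Real.exp (-(s * D.interference X C A H i b ω)))) :=
      (Real.continuous_exp.tendsto _).comp
        (((hsum i b).hasSum.tendsto_sum_nat.const_mul s).neg)
    by_cases hω : ENNReal.ofReal a ≤ nearest X C i ω
    · rw [indicator_of_mem (by exact hω)]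
      rw [ofReal_le_nearest_iff] at hω
      have h1 : ∀ n, (∏ j ∈ Finset.range n, if C j ω = i ∧ ‖X j ω‖ < a then (0 : ℝ) else 1) = 1 :=
        fun n => Finset.prod_eq_one fun j _ =>
          if_neg fun hj => absurd (hω j hj.1) (not_le.2 hj.2)
      simpa [h1] using hexp
    · rw [indicator_of_notMem (by exact hω)]
      rw [ofReal_le_nearest_iff] at hω
      push Not at hω
      obtain ⟨j, hj1, hj2⟩ := hω
      refine tendsto_const_nhds.congr' ?_
      filter_upwards [eventually_gt_atTop j] with n hn
      have hz : (∏ j ∈ Finset.range n, if C j ω = i ∧ ‖X j ω‖ < a then (0 : ℝ) else 1) = 0 :=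
        Finset.prod_eq_zero (Finset.mem_range.2 hn) (if_pos ⟨hj1, hj2⟩)
      rw [hz, zero_mul]

end IsNetwork

end D2DParams

/-! ### Increments of the coverage function over a thin annulus. -/

/-- The probability is `1 - exp (-r) * (1 + r)`, and `exp (-r) ≥ 1 - r`. -/
theorem poissonMeasure_two_le (r : ℝ≥0) :
    (poissonMeasure r).real {n | 2 ≤ n} ≤ (r : ℝ) ^ 2 := by
  have h : {n : ℕ | 2 ≤ n} = ({0, 1} : Set ℕ)ᶜ := by
    ext n; simp only [mem_ofPred_eq, mem_compl_iff, mem_insert_iff, mem_singleton_iff]; omega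
  rw [h, probReal_compl_eq_one_sub (by measurability), measureReal_def,
    show ({0, 1} : Set ℕ) = {0} ∪ {1} from rfl,
    measure_union (by simp) (measurableSet_singleton 1), ENNReal.toReal_add (by simp) (by simp),
    ← measureReal_def, ← measureReal_def, poissonMeasure_real_singleton,
    poissonMeasure_real_singleton]
  simp
  have h1 := Real.add_one_le_exp (-(r : ℝ))
  have h2 : (0 : ℝ) ≤ r := r.2
  nlinarith

theorem IsPoissonProcess.measure_two_le {Ω : Type*} [MeasurableSpace Ω] {X : ℕ → Ω → Plane}
    {ν : Measure Plane} {P : Measure Ω} (h : IsPoissonProcess X ν P) {S : Set Plane}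
    (hS : MeasurableSet S) (hν : ν S ≠ ∞) :
    NullMeasurableSet {ω | 2 ≤ pointCount X S ω} P ∧
      P.real {ω | 2 ≤ pointCount X S ω} ≤ (ν S).toReal ^ 2 := by
  have hl := h.law_count S hS hν
  refine ⟨hl.aemeasurable.nullMeasurable (MeasurableSet.of_discrete (s := {n : ℕ∞ | 2 ≤ n})), ?_⟩
  rw [hl.measureReal_eq (p := fun n => 2 ≤ n) MeasurableSet.of_discrete,
    map_measureReal_apply (measurable_of_countable _) MeasurableSet.of_discrete]
  have : (fun n : ℕ => (n : ℕ∞)) ⁻¹' {x | 2 ≤ x} = {n | 2 ≤ n} := by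
    ext n; simp only [mem_preimage, mem_ofPred_eq]; exact_mod_cast Iff.rfl
  rw [this]
  exact poissonMeasure_two_le _

namespace D2DParams

variable {N : ℕ} (D : D2DParams N)

/-- Continuous version of the primitive of `1 / (1 + t ^ (α / 2))`. -/
theorem continuous_primitive_xi :
    Continuous fun T : ℝ => ∫ t in (0 : ℝ)..T,
      (Ioi (0 : ℝ)).indicator (fun t => 1 / (1 + t ^ (D.alpha / 2))) t := by
  have hint := integrableOn_one_div_one_add_rpow (p := D.alpha / 2)
      (by have := D.alpha_gt; linarith)
  -- The indicator makes the integrand integrable on the whole line, whatever real powers of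
  -- negative numbers are.
  exact intervalIntegral.continuous_primitive (fun a b =>
    ((integrable_indicator_iff measurableSet_Ioi).2 hint).intervalIntegrable) 0

theorem primitive_xi_eq {T : ℝ} (hT : 0 ≤ T) :
    ∫ t in (0 : ℝ)..T, (Ioi (0 : ℝ)).indicator (fun t => 1 / (1 + t ^ (D.alpha / 2))) t =
      ∫ t in (0 : ℝ)..T, 1 / (1 + t ^ (D.alpha / 2)) := by
  refine intervalIntegral.integral_congr_ae (ae_of_all _ fun t ht => ?_)
  rw [uIoc_of_le hT] at ht
  rw [indicator_of_mem (show t ∈ Ioi (0 : ℝ) from ht.1)]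

theorem continuous_interfExponent (i : Fin N) {s : ℝ} (hs : 0 ≤ s) :
    Continuous fun b => D.interfExponent i b s := by
  have h1 : (fun b => D.interfExponent i b s) = fun b => Real.pi * s ^ (2 / D.alpha) *
      (D.lamI * D.xi1 - D.lamDT i * ∫ t in (0 : ℝ)..s ^ (-(2 / D.alpha)) * b ^ 2,
        (Ioi (0 : ℝ)).indicator (fun t => 1 / (1 + t ^ (D.alpha / 2))) t) := by
    funext b
    rw [D.primitive_xi_eq (mul_nonneg (Real.rpow_nonneg hs _) (sq_nonneg b)), interfExponent]
  rw [h1]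
  have h2 := D.continuous_primitive_xi.comp
    (f := fun b : ℝ => s ^ (-(2 / D.alpha)) * b ^ 2) (by fun_prop)
  exact (continuous_const.sub (h2.const_mul _)).const_mul _

/-- At the Laplace variable `s = x * b ^ α` the limit `s ^ (-(2 / α)) * b ^ 2` reduces to `x ^ (-(2
/ α))`, which is why `xi2` depends on the threshold alone. -/
theorem phi_eq (i : Fin N) {x b : ℝ} (hx : 0 < x) (hb : 0 < b) :
    D.phi i x b = x * b ^ D.alpha * (D.sigma2 / D.Pt) + D.interfExponent i b (x * b ^ D.alpha) := by
  have hα : D.alpha ≠ 0 := by have := D.alpha_gt; linarith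
  have h1 : (x * b ^ D.alpha) ^ (2 / D.alpha) = x ^ (2 / D.alpha) * b ^ 2 := by
    rw [Real.mul_rpow hx.le (Real.rpow_nonneg hb.le _), ← Real.rpow_mul hb.le,
      show D.alpha * (2 / D.alpha) = 2 by field_simp, Real.rpow_two]
  have h2 : (x * b ^ D.alpha) ^ (-(2 / D.alpha)) * b ^ 2 = x ^ (-(2 / D.alpha)) := by
    rw [Real.rpow_neg (by positivity), h1, Real.rpow_neg hx.le]
    field_simp
  rw [interfExponent, h1, h2, phi, xi2]
  ring

theorem continuous_phi (i : Fin N) (x : ℝ) : Continuous fun r => D.phi i x r := by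
  have := Real.continuous_rpow_const (q := D.alpha) (by have := D.alpha_gt; linarith)
  unfold phi
  fun_prop

theorem continuous_linkPdf (i : Fin N) : Continuous fun r => D.linkPdf i r := by
  unfold linkPdf
  fun_prop

theorem hasDerivAt_exp_lamFile (i : Fin N) (r : ℝ) :
    HasDerivAt (fun r => Real.exp (-(D.lamFile i * Real.pi * r ^ 2))) (-D.linkPdf i r) r := by
  have h := (((hasDerivAt_pow 2 r).const_mul (D.lamFile i * Real.pi)).neg).exp
  refine h.congr_deriv ?_
  simp only [Pi.neg_apply]
  unfold linkPdf
  push_cast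
  ring

theorem lamFile_nonneg (i : Fin N) : 0 ≤ D.lamFile i := mul_nonneg D.lam_pos.le (D.pc_nonneg i)

/-- Probability that a user caching file `i` is at distance less than `r`, and that the nearest one
serves the receiver with signal to interference plus noise ratio at least `x`. -/
def coverage {Ω : Type*} [MeasurableSpace Ω] (P : Measure Ω) (X : ℕ → Ω → Plane)
    (C : ℕ → Ω → Fin N) (A : ℕ → Ω → Bool) (H : ℕ → Ω → ℝ) (i : Fin N) (x r : ℝ) : ℝ :=
  ∫ ω, {ω | nearest X C i ω < ENNReal.ofReal r}.indicator
    (fun ω => Real.exp (-(x * D.linkLoad X C A H i ω))) ω ∂P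

namespace IsNetwork

variable {D} {Ω : Type*} [MeasurableSpace Ω] {P : Measure Ω} {X : ℕ → Ω → Plane}
  {C : ℕ → Ω → Fin N} {A : ℕ → Ω → Bool} {H : ℕ → Ω → ℝ} {J : Ω → Fin N} {G : Ω → ℝ}

theorem interference_nonneg {ω : Ω} (hω : ∀ j, 0 < H j ω) (i : Fin N) (r : ℝ) :
    0 ≤ D.interference X C A H i r ω :=
  tsum_nonneg fun j => interferenceTerm_nonneg hω i r j

theorem noise_pos : 0 < D.sigma2 / D.Pt := div_pos D.sigma2_pos D.Pt_pos

theorem linkLoad_nonneg {ω : Ω} (hω : ∀ j, 0 < H j ω) (i : Fin N) :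
    0 ≤ D.linkLoad X C A H i ω :=
  mul_nonneg (Real.rpow_nonneg ENNReal.toReal_nonneg _)
    (add_nonneg (interference_nonneg hω i _) noise_pos.le)

theorem measurable_nearest (h : D.IsNetwork P X C A H J G) (i : Fin N) :
    Measurable (nearest X C i) :=
  D2DParams.measurable_nearest h.users.measurable_point h.measurable_cache i

theorem measurable_linkLoad (h : D.IsNetwork P X C A H J G) (i : Fin N) :
    Measurable (D.linkLoad X C A H i) :=
  D.measurable_linkLoad h.users.measurable_point h.measurable_cache
      h.measurable_active h.measurable_fading i

theorem measurable_interference (h : D.IsNetwork P X C A H J G) (i : Fin N) (r : ℝ) :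
    Measurable (D.interference X C A H i r) :=
  D.measurable_interference h.users.measurable_point h.measurable_cache
      h.measurable_active h.measurable_fading i (R := fun _ => r) measurable_const

variable [IsProbabilityMeasure P]

theorem integrable_exp_neg {f : Ω → ℝ} (hf : Measurable f) (hf0 : ∀ᵐ ω ∂P, 0 ≤ f ω) :
    Integrable (fun ω => Real.exp (-f ω)) P := by
  refine Integrable.of_bound (C := 1) (by fun_prop) ?_
  filter_upwards [hf0] with ω hω
  rw [Real.norm_of_nonneg (Real.exp_nonneg _)]
  exact Real.exp_le_one_iff.2 (neg_nonpos.2 hω)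

theorem integrable_exp_linkLoad (h : D.IsNetwork P X C A H J G) (i : Fin N) {x : ℝ} (hx : 0 ≤ x) :
    Integrable (fun ω => Real.exp (-(x * D.linkLoad X C A H i ω))) P := by
  refine integrable_exp_neg ((h.measurable_linkLoad i).const_mul x) ?_
  filter_upwards [h.ae_fading_pos] with ω hω using mul_nonneg hx (linkLoad_nonneg hω i)

theorem integrable_exp_interference (h : D.IsNetwork P X C A H J G) (i : Fin N) (b : ℝ) {s : ℝ}
    (hs : 0 ≤ s) : Integrable (fun ω => Real.exp (-(s * D.interference X C A H i b ω))) P := by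
  refine integrable_exp_neg ((h.measurable_interference i b).const_mul s) ?_
  filter_upwards [h.ae_fading_pos] with ω hω using mul_nonneg hs (interference_nonneg hω i b)

/-- The event that the distance to the nearest user caching file `i` is in `[a, b)`. -/
def nearestIn (X : ℕ → Ω → Plane) (C : ℕ → Ω → Fin N) (i : Fin N) (a b : ℝ) : Set Ω :=
  {ω | ENNReal.ofReal a ≤ nearest X C i ω ∧ nearest X C i ω < ENNReal.ofReal b}

theorem measurableSet_nearestIn (h : D.IsNetwork P X C A H J G) (i : Fin N) (a b : ℝ) :
    MeasurableSet (nearestIn X C i a b) :=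
  (measurableSet_le measurable_const (h.measurable_nearest i)).inter
    (measurableSet_lt (h.measurable_nearest i) measurable_const)

theorem coverage_sub (h : D.IsNetwork P X C A H J G) (i : Fin N) {x a b : ℝ} (hx : 0 ≤ x)
    (hab : a ≤ b) :
    D.coverage P X C A H i x b - D.coverage P X C A H i x a =
      ∫ ω in nearestIn X C i a b, Real.exp (-(x * D.linkLoad X C A H i ω)) ∂P := by
  have hm : ∀ r : ℝ, MeasurableSet {ω | nearest X C i ω < ENNReal.ofReal r} := fun r =>
    measurableSet_lt (h.measurable_nearest i) measurable_const
  have hi := h.integrable_exp_linkLoad i hx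
  unfold coverage
  rw [← integral_indicator (h.measurableSet_nearestIn i a b), ← integral_sub
    (hi.indicator (hm b)) (hi.indicator (hm a))]
  refine integral_congr_ae (ae_of_all _ fun ω => ?_)
  have hle := ENNReal.ofReal_le_ofReal hab
  by_cases h1 : nearest X C i ω < ENNReal.ofReal a
  · simp [indicator, nearestIn, h1, h1.trans_le hle, not_le.2 h1]
  · by_cases h2 : nearest X C i ω < ENNReal.ofReal b <;>
      simp [indicator, nearestIn, h1, h2, not_lt.1 h1]

/-- The void formula is used with radii `a` and `b` for the same interference beyond `b`;
subtracting leaves the event that the link distance lies in between. This is what the two separate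
radii are for. -/
theorem setIntegral_exp_interference (h : D.IsNetwork P X C A H J G) (i : Fin N) {a b s : ℝ}
    (ha : 0 ≤ a) (hab : a ≤ b) (hs : 0 ≤ s) :
    ∫ ω in nearestIn X C i a b, Real.exp (-(s * D.interference X C A H i b ω)) ∂P =
      (Real.exp (-(D.lamFile i * Real.pi * a ^ 2)) - Real.exp (-(D.lamFile i * Real.pi * b ^ 2))) *
        Real.exp (-D.interfExponent i b s) := by
  obtain ⟨i1, e1⟩ := h.integral_exp_interference i ha hab hs
  obtain ⟨i2, e2⟩ := h.integral_exp_interference i (ha.trans hab) le_rfl hs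
  rw [sub_mul, ← Real.exp_add, ← Real.exp_add, ← neg_add, ← neg_add, ← e1, ← e2,
    ← integral_indicator (h.measurableSet_nearestIn i a b), ← integral_sub i1 i2]
  refine integral_congr_ae (ae_of_all _ fun ω => ?_)
  have hle := ENNReal.ofReal_le_ofReal hab
  by_cases h1 : ENNReal.ofReal b ≤ nearest X C i ω
  · simp [indicator, nearestIn, h1, hle.trans h1, not_lt.2 h1]
  · by_cases h2 : ENNReal.ofReal a ≤ nearest X C i ω <;>
      simp [indicator, nearestIn, h1, h2, not_le.1 h1]

theorem toReal_mem_of_nearestIn {i : Fin N} {a b : ℝ} {ω : Ω}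
    (hω : ω ∈ nearestIn X C i a b) : nearest X C i ω ≠ ∞ ∧
      a ≤ (nearest X C i ω).toReal ∧ (nearest X C i ω).toReal ≤ b := by
  have hfin : nearest X C i ω ≠ ∞ := (hω.2.trans ENNReal.ofReal_lt_top).ne
  refine ⟨hfin, (ENNReal.ofReal_le_iff_le_toReal hfin).1 hω.1, ?_⟩
  have hb : 0 < b := ENNReal.ofReal_pos.1 (bot_le.trans_lt hω.2)
  exact ENNReal.toReal_le_of_le_ofReal hb.le hω.2.le

/-- Since the link distance lies in `[a, b]`, replacing it by `a` in the path loss and by `b` in the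
exclusion radius can only decrease the load. -/
theorem coverage_sub_le (h : D.IsNetwork P X C A H J G) (i : Fin N) {x a b : ℝ} (hx : 0 ≤ x)
    (ha : 0 ≤ a) (hab : a ≤ b) :
    D.coverage P X C A H i x b - D.coverage P X C A H i x a ≤
      Real.exp (-(x * a ^ D.alpha * (D.sigma2 / D.Pt))) *
      ((Real.exp (-(D.lamFile i * Real.pi * a ^ 2)) -
        Real.exp (-(D.lamFile i * Real.pi * b ^ 2))) *
          Real.exp (-D.interfExponent i b (x * a ^ D.alpha))) := by
  have hα : 0 ≤ D.alpha := by have := D.alpha_gt; linarith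
  have hs : 0 ≤ x * a ^ D.alpha := mul_nonneg hx (Real.rpow_nonneg ha _)
  rw [h.coverage_sub i hx hab, ← h.setIntegral_exp_interference i ha hab hs, ← integral_const_mul]
  refine setIntegral_mono_on_ae (h.integrable_exp_linkLoad i hx).integrableOn
    ((h.integrable_exp_interference i b hs).integrableOn.const_mul _)
    (h.measurableSet_nearestIn i a b) ?_
  filter_upwards [h.ae_summable, h.ae_fading_pos] with ω hsum hω hmem
  obtain ⟨_, hRa, hRb⟩ := toReal_mem_of_nearestIn hmem
  rw [← Real.exp_add]
  refine Real.exp_le_exp.2 ?_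
  have h1 : D.interference X C A H i b ω ≤
      D.interference X C A H i (nearest X C i ω).toReal ω :=
    (hsum i b).tsum_le_tsum (fun j => interferenceTerm_anti hω i hRb j) (hsum i _)
  have h2 : a ^ D.alpha ≤ (nearest X C i ω).toReal ^ D.alpha := Real.rpow_le_rpow ha hRa hα
  have h3 : a ^ D.alpha * (D.interference X C A H i b ω + D.sigma2 / D.Pt) ≤
      D.linkLoad X C A H i ω := by
    unfold linkLoad
    refine mul_le_mul h2 (by linarith) (add_nonneg (interference_nonneg hω i b) noise_pos.le)
      (Real.rpow_nonneg ENNReal.toReal_nonneg _)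
  have h4 := mul_le_mul_of_nonneg_left h3 hx
  nlinarith

/-- If no two users are in the annulus, the interference depends on the link distance only through
the annulus that contains it. -/
theorem interference_eq_of_pointCount_lt {i : Fin N} {a b : ℝ} {ω : Ω}
    (hω : ω ∈ nearestIn X C i a b)
    (hc : ¬ 2 ≤ pointCount X {y | a ≤ ‖y‖ ∧ ‖y‖ ≤ b} ω) :
    D.interference X C A H i (nearest X C i ω).toReal ω = D.interference X C A H i b ω := by
  obtain ⟨hfin, hRa, hRb⟩ := toReal_mem_of_nearestIn hω
  unfold interference
  refine tsum_congr fun j => ?_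
  unfold interferenceTerm
  have key : C j ω = i → ((nearest X C i ω).toReal < ‖X j ω‖ ↔ b < ‖X j ω‖) := by
    intro hj
    refine ⟨fun hlt => ?_, fun hlt => hRb.trans_lt hlt⟩
    by_contra hbj
    -- It does not matter whether the nearest distance is attained: some user `k` of file `i` is
    -- strictly closer than `j`, and both lie in the annulus.
    obtain ⟨k, hk, hkj⟩ := (nearest_toReal_lt_iff hfin).1 hlt
    have hak := ofReal_le_nearest_iff.1 hω.1 k hk
    have hne : k ≠ j := by rintro rfl; exact lt_irrefl _ hkj
    refine hc ?_
    rw [← Set.encard_pair hne]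
    refine Set.encard_le_encard ?_
    rintro l (rfl | rfl)
    · exact ⟨hak, hkj.le.trans (not_lt.1 hbj)⟩
    · exact ⟨hak.trans hkj.le, not_lt.1 hbj⟩
  have : (A j ω = true ∧ (C j ω = i → (nearest X C i ω).toReal < ‖X j ω‖)) ↔
      (A j ω = true ∧ (C j ω = i → b < ‖X j ω‖)) := and_congr_right fun _ => forall_congr' key
  simp only [this]

theorem intensity_annulus {a b : ℝ} (ha : 0 ≤ a) (hab : a ≤ b) :
    (ENNReal.ofReal D.lam • (volume : Measure Plane)) {y | a ≤ ‖y‖ ∧ ‖y‖ ≤ b} =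
      ENNReal.ofReal (D.lam * Real.pi * (b ^ 2 - a ^ 2)) := by
  have h : {y : Plane | a ≤ ‖y‖ ∧ ‖y‖ ≤ b} = Metric.closedBall 0 b \ Metric.ball 0 a := by
    ext y; simp [and_comm]
  rw [h, Measure.smul_apply, measure_sdiff (Metric.ball_subset_closedBall.trans
      (Metric.closedBall_subset_closedBall hab)) Metric.isOpen_ball.measurableSet.nullMeasurableSet
      measure_ball_lt_top.ne, EuclideanSpace.volume_ball_fin_two,
    EuclideanSpace.volume_closedBall_fin_two, ← ENNReal.ofReal_pow ha,
    ← ENNReal.ofReal_pow (ha.trans hab), smul_eq_mul]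
  rw [← ENNReal.ofReal_mul (by positivity), ← ENNReal.ofReal_mul (by positivity),
    ← ENNReal.ofReal_sub _ (by positivity), ← ENNReal.ofReal_mul D.lam_pos.le]
  congr 1; ring

/-- Replacing the distance by `b` in the path loss increases the load, while the interference is
exactly that beyond `b` unless the annulus holds two points. The subtracted square, the squared mean
count, bounds the probability of that exception. -/
theorem le_coverage_sub (h : D.IsNetwork P X C A H J G) (i : Fin N) {x a b : ℝ} (hx : 0 ≤ x)
    (ha : 0 ≤ a) (hab : a ≤ b) :
    Real.exp (-(x * b ^ D.alpha * (D.sigma2 / D.Pt))) *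
      ((Real.exp (-(D.lamFile i * Real.pi * a ^ 2)) -
        Real.exp (-(D.lamFile i * Real.pi * b ^ 2))) *
          Real.exp (-D.interfExponent i b (x * b ^ D.alpha))) -
      (D.lam * Real.pi * (b ^ 2 - a ^ 2)) ^ 2 ≤
    D.coverage P X C A H i x b - D.coverage P X C A H i x a := by
  have hα : 0 ≤ D.alpha := by have := D.alpha_gt; linarith
  have hb : 0 ≤ b := ha.trans hab
  have hs : 0 ≤ x * b ^ D.alpha := mul_nonneg hx (Real.rpow_nonneg hb _)
  set S : Set Plane := {y | a ≤ ‖y‖ ∧ ‖y‖ ≤ b} with hSdef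
  have hS : MeasurableSet S := (measurableSet_le measurable_const measurable_norm).inter
    (measurableSet_le measurable_norm measurable_const)
  have hν := intensity_annulus (D := D) ha hab
  obtain ⟨hnull, htwo⟩ := h.users.measure_two_le hS (by rw [hν]; simp)
  rw [hν, ENNReal.toReal_ofReal (mul_nonneg (mul_nonneg D.lam_pos.le Real.pi_nonneg)
    (by nlinarith))] at htwo
  have hI : Integrable ({ω | 2 ≤ pointCount X S ω}.indicator (1 : Ω → ℝ)) P :=
    (integrable_const (1 : ℝ)).indicator₀ hnull
  have hI' : ∫ ω in nearestIn X C i a b, {ω | 2 ≤ pointCount X S ω}.indicator (1 : Ω → ℝ) ω ∂P ≤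
      P.real {ω | 2 ≤ pointCount X S ω} := by
    have h1 : ∫ ω, {ω | 2 ≤ pointCount X S ω}.indicator (1 : Ω → ℝ) ω ∂P =
        P.real {ω | 2 ≤ pointCount X S ω} := by
      rw [integral_indicator₀ hnull]; simp
    rw [← h1]
    exact setIntegral_le_integral hI (ae_of_all _ fun ω => indicator_nonneg (by simp) _)
  have hE := (h.integrable_exp_interference i b hs).integrableOn (s := nearestIn X C i a b)
  have hmain : ∫ ω in nearestIn X C i a b, (Real.exp (-(x * b ^ D.alpha * (D.sigma2 / D.Pt))) *
        Real.exp (-(x * b ^ D.alpha * D.interference X C A H i b ω)) -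
          {ω | 2 ≤ pointCount X S ω}.indicator (1 : Ω → ℝ) ω) ∂P ≤
      ∫ ω in nearestIn X C i a b, Real.exp (-(x * D.linkLoad X C A H i ω)) ∂P := by
    refine setIntegral_mono_on_ae ((hE.const_mul _).sub hI.integrableOn)
      (h.integrable_exp_linkLoad i hx).integrableOn (h.measurableSet_nearestIn i a b) ?_
    filter_upwards [h.ae_fading_pos] with ω hω hmem
    obtain ⟨_, hRa, hRb⟩ := toReal_mem_of_nearestIn hmem
    rw [← Real.exp_add]
    -- On the exceptional event the left integrand is at most `1 - 1`, hence below any exponential.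
    by_cases hc : 2 ≤ pointCount X S ω
    · rw [indicator_of_mem (by exact hc)]
      have h1 : Real.exp (-(x * b ^ D.alpha * (D.sigma2 / D.Pt)) +
          -(x * b ^ D.alpha * D.interference X C A H i b ω)) ≤ 1 := by
        refine Real.exp_le_one_iff.2 ?_
        have h2 := mul_nonneg hs (noise_pos (D := D)).le
        have h3 := mul_nonneg hs (interference_nonneg (X := X) (C := C) (A := A) hω (D := D) i b)
        linarith
      have := Real.exp_nonneg (-(x * D.linkLoad X C A H i ω))
      simp only [Pi.one_apply]
      linarith
    · rw [indicator_of_notMem (by exact hc), sub_zero]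
      refine Real.exp_le_exp.2 ?_
      have h2 : (nearest X C i ω).toReal ^ D.alpha ≤ b ^ D.alpha :=
        Real.rpow_le_rpow ENNReal.toReal_nonneg hRb hα
      have h3 : D.linkLoad X C A H i ω ≤
          b ^ D.alpha * (D.interference X C A H i b ω + D.sigma2 / D.Pt) := by
        unfold linkLoad
        rw [interference_eq_of_pointCount_lt hmem hc]
        exact mul_le_mul_of_nonneg_right h2
          (add_nonneg (interference_nonneg hω i b) noise_pos.le)
      have h4 := mul_le_mul_of_nonneg_left h3 hx
      nlinarith
  rw [integral_sub (hE.const_mul _) hI.integrableOn, integral_const_mul,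
    h.setIntegral_exp_interference i ha hab hs, ← h.coverage_sub i hx hab] at hmain
  linarith

end IsNetwork

end D2DParams

/-! ### Closed form of the coverage function and the role of the link gain. -/

namespace D2DParams.IsNetwork

variable {N : ℕ} {D : D2DParams N} {Ω : Type*} [MeasurableSpace Ω] {P : Measure Ω}
  {X : ℕ → Ω → Plane} {C : ℕ → Ω → Fin N} {A : ℕ → Ω → Bool} {H : ℕ → Ω → ℝ} {J : Ω → Fin N}
  {G : Ω → ℝ} [IsProbabilityMeasure P]

theorem hasDerivWithinAt_coverage (h : D.IsNetwork P X C A H J G) (i : Fin N) {x a : ℝ}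
    (hx : 0 < x) (ha : 0 < a) :
    HasDerivWithinAt (D.coverage P X C A H i x) (D.linkPdf i a * Real.exp (-D.phi i x a))
      (Ioi a) a := by
  have hs : 0 ≤ x * a ^ D.alpha := mul_nonneg hx.le (Real.rpow_nonneg ha.le _)
  rw [hasDerivWithinAt_iff_tendsto_slope' (by simp)]
  set E : ℝ → ℝ := fun r => Real.exp (-(D.lamFile i * Real.pi * r ^ 2)) with hE
  have hd : Tendsto (fun b => (E a - E b) / (b - a)) (𝓝[>] a) (𝓝 (D.linkPdf i a)) := by
    have h1 := ((hasDerivWithinAt_iff_tendsto_slope' self_notMem_Ioi).1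
      ((D.hasDerivAt_exp_lamFile i a).hasDerivWithinAt (s := Ioi a))).neg
    rw [neg_neg] at h1
    refine h1.congr fun b => ?_
    rw [slope_def_field, ← neg_div, neg_sub]
  have hup : Tendsto (fun b => Real.exp (-(x * a ^ D.alpha * (D.sigma2 / D.Pt))) *
      ((E a - E b) / (b - a) * Real.exp (-D.interfExponent i b (x * a ^ D.alpha)))) (𝓝[>] a)
      (𝓝 (D.linkPdf i a * Real.exp (-D.phi i x a))) := by
    have h1 : D.linkPdf i a * Real.exp (-D.phi i x a) =
        Real.exp (-(x * a ^ D.alpha * (D.sigma2 / D.Pt))) *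
          (D.linkPdf i a * Real.exp (-D.interfExponent i a (x * a ^ D.alpha))) := by
      rw [D.phi_eq i hx ha, neg_add, Real.exp_add]; ring
    rw [h1]
    exact (hd.mul ((Real.continuous_exp.comp (D.continuous_interfExponent i hs).neg).tendsto a
      |>.mono_left nhdsWithin_le_nhds)).const_mul _
  have hlow : Tendsto (fun b => (E a - E b) / (b - a) * Real.exp (-D.phi i x b) -
      (D.lam * Real.pi * (b + a)) ^ 2 * (b - a)) (𝓝[>] a)
      (𝓝 (D.linkPdf i a * Real.exp (-D.phi i x a))) := by
    -- This is the two-point error `(λ π (b ^ 2 - a ^ 2)) ^ 2` divided by `b - a`; it vanishes in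
    -- the limit.
    have h1 : Tendsto (fun b => (D.lam * Real.pi * (b + a)) ^ 2 * (b - a)) (𝓝[>] a) (𝓝 0) := by
      have hc : Continuous fun b => (D.lam * Real.pi * (b + a)) ^ 2 * (b - a) := by fun_prop
      have := (hc.tendsto a).mono_left (nhdsWithin_le_nhds (s := Ioi a))
      simpa using this
    have h2 := (hd.mul ((Real.continuous_exp.comp (D.continuous_phi i x).neg).tendsto a
      |>.mono_left nhdsWithin_le_nhds)).sub h1
    simpa using h2
  refine tendsto_of_tendsto_of_tendsto_of_le_of_le' hlow hup ?_ ?_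
  · filter_upwards [self_mem_nhdsWithin] with b hb
    have hb' : 0 < b - a := sub_pos.2 hb
    have h1 := h.le_coverage_sub i hx.le ha.le (le_of_lt hb)
    rw [slope_def_field, le_div_iff₀ hb']
    refine le_trans (le_of_eq ?_) h1
    rw [D.phi_eq i hx (ha.trans hb), neg_add, Real.exp_add]
    simp only [hE]
    field_simp
    ring
  · filter_upwards [self_mem_nhdsWithin] with b hb
    have hb' : 0 < b - a := sub_pos.2 hb
    have h1 := h.coverage_sub_le i hx.le ha.le (le_of_lt hb)
    rw [slope_def_field, div_le_iff₀ hb']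
    refine h1.trans (le_of_eq ?_)
    simp only [hE]
    field_simp

theorem interfExponent_zero (i : Fin N) (b : ℝ) : D.interfExponent i b 0 = 0 := by
  have : 2 / D.alpha ≠ 0 := by have := D.alpha_gt; positivity
  simp [interfExponent, Real.zero_rpow this]

/-- The increments are dominated by those of the void probability `E`, because the integrand is at
most `1`. -/
theorem continuousOn_coverage (h : D.IsNetwork P X C A H J G) (i : Fin N) {x : ℝ} (hx : 0 ≤ x)
    (r : ℝ) : ContinuousOn (D.coverage P X C A H i x) (Icc 0 r) := by
  set E : ℝ → ℝ := fun r => Real.exp (-(D.lamFile i * Real.pi * r ^ 2)) with hE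
  have hle : ∀ a b, 0 ≤ a → a ≤ b →
      |D.coverage P X C A H i x b - D.coverage P X C A H i x a| ≤ |E b - E a| := by
    intro a b ha hab
    rw [h.coverage_sub i hx hab, abs_of_nonneg
      (integral_nonneg fun ω => Real.exp_nonneg _), abs_sub_comm]
    refine le_trans ?_ (le_abs_self _)
    -- Laplace variable `0` turns the integral into the probability of the annulus event.
    have h1 := h.setIntegral_exp_interference i ha hab le_rfl
    rw [interfExponent_zero, neg_zero, Real.exp_zero, mul_one] at h1
    rw [← h1]
    refine setIntegral_mono_on_ae (h.integrable_exp_linkLoad i hx).integrableOn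
      (h.integrable_exp_interference i b le_rfl).integrableOn (h.measurableSet_nearestIn i a b) ?_
    filter_upwards [h.ae_fading_pos] with ω hω _
    refine Real.exp_le_exp.2 ?_
    have := mul_nonneg hx (linkLoad_nonneg (X := X) (C := C) (A := A) (D := D) hω i)
    linarith
  have hE' : Continuous E := by fun_prop
  intro a ha
  rw [ContinuousWithinAt, tendsto_iff_dist_tendsto_zero]
  have h1 := (tendsto_iff_dist_tendsto_zero.1 (hE'.tendsto a)).mono_left
    (nhdsWithin_le_nhds (s := Icc 0 r))
  refine squeeze_zero' (Eventually.of_forall fun _ => dist_nonneg) ?_ h1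
  filter_upwards [self_mem_nhdsWithin] with b hb
  rw [Real.dist_eq, Real.dist_eq]
  rcases le_total a b with hab | hab
  · exact hle a b ha.1 hab
  · rw [abs_sub_comm, abs_sub_comm (E b)]
    exact hle b a hb.1 hab

/-- Closed form of the coverage probability. -/
theorem coverage_eq (h : D.IsNetwork P X C A H J G) (i : Fin N) {x r : ℝ} (hx : 0 < x)
    (hr : 0 ≤ r) : D.coverage P X C A H i x r =
      ∫ y in (0 : ℝ)..r, D.linkPdf i y * Real.exp (-D.phi i x y) := by
  have hc : Continuous fun y => D.linkPdf i y * Real.exp (-D.phi i x y) :=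
    (D.continuous_linkPdf i).mul (Real.continuous_exp.comp (D.continuous_phi i x).neg)
  -- Continuity together with a right derivative in the interior suffices for the fundamental
  -- theorem.
  rw [intervalIntegral.integral_eq_sub_of_hasDeriv_right_of_le hr (h.continuousOn_coverage i hx.le r)
    (fun y hy => h.hasDerivWithinAt_coverage i hx hy.1) (hc.intervalIntegrable _ _)]
  have : D.coverage P X C A H i x 0 = 0 := by
    simp [coverage]
  rw [this, sub_zero]

/-- Positions are independent of the pair (marks, link), and marks of the link; reassociating the
triple product law separates the link from everything else. -/
theorem indep_users_link (h : D.IsNetwork P X C A H J G) :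
    IndepFun (fun ω => ((fun j => X j ω), fun j => (C j ω, A j ω, H j ω)))
      (fun ω => (J ω, G ω)) P := by
  have hX : Measurable fun ω j => X j ω := measurable_pi_lambda _ h.users.measurable_point
  have hM : Measurable fun ω j => (C j ω, A j ω, H j ω) := measurable_pi_lambda _ fun j =>
    (h.measurable_cache j).prodMk ((h.measurable_active j).prodMk (h.measurable_fading j))
  have hL : Measurable fun ω => (J ω, G ω) := h.measurable_request.prodMk h.measurable_gain
  have h1 := h.indep_positions.map_prod_eq_prod_map_map hX.aemeasurable (hM.prodMk hL).aemeasurable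
  have h2 := h.indep_marks.map_prod_eq_prod_map_map hM.aemeasurable hL.aemeasurable
  have h3 := h.indep_positions_marks.map_prod_eq_prod_map_map hX.aemeasurable hM.aemeasurable
  have := Measure.isProbabilityMeasure_map (μ := P) hX.aemeasurable
  have := Measure.isProbabilityMeasure_map (μ := P) hM.aemeasurable
  have := Measure.isProbabilityMeasure_map (μ := P) hL.aemeasurable
  rw [indepFun_iff_map_prod_eq_prod_map_map (hX.prodMk hM).aemeasurable hL.aemeasurable, h3]
  have h4 : Measurable (MeasurableEquiv.prodAssoc (α := ℕ → Plane) (β := ℕ → Fin N × Bool × ℝ)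
    (γ := Fin N × ℝ)).symm := MeasurableEquiv.measurable _
  have h5 := congrArg (Measure.map (MeasurableEquiv.prodAssoc (α := ℕ → Plane)
    (β := ℕ → Fin N × Bool × ℝ) (γ := Fin N × ℝ)).symm) h1
  rw [Measure.map_map h4 (hX.prodMk (hM.prodMk hL)), h2] at h5
  refine Eq.trans ?_ (h5.trans ?_)
  · rfl
  · rw [← Measure.prodAssoc_prod, Measure.map_map h4 (MeasurableEquiv.measurable _)]
    simp

/-- Probability that file `i` is requested, that it is cached within distance `r`, and that the link
has signal to interference plus noise ratio at least `x`. -/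
theorem measureReal_served (h : D.IsNetwork P X C A H J G) (i : Fin N) {x : ℝ} (hx : 0 ≤ x)
    (r : ℝ) :
    P.real {ω | J ω = i ∧ nearest X C i ω < ENNReal.ofReal r ∧
      x * D.linkLoad X C A H i ω ≤ G ω} = D.pr i * D.coverage P X C A H i x r := by
  let Y : Ω → (ℕ → Plane) × (ℕ → Fin N × Bool × ℝ) := fun ω => ((fun j => X j ω), fun j => (C j ω, A j ω, H j ω))
  -- Nearest distance and load are viewed as functions on the space of sequences, so that Fubini's
  -- theorem can freeze the network and integrate over `(J, G)` alone.
  let nu : (ℕ → Plane) × (ℕ → Fin N × Bool × ℝ) → ℝ≥0∞ := nearest (fun j (y : (ℕ → Plane) × (ℕ → Fin N × Bool × ℝ)) => y.1 j) (fun j (y : (ℕ → Plane) × (ℕ → Fin N × Bool × ℝ)) => (y.2 j).1) i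
  let lu : (ℕ → Plane) × (ℕ → Fin N × Bool × ℝ) → ℝ := D.linkLoad (fun j (y : (ℕ → Plane) × (ℕ → Fin N × Bool × ℝ)) => y.1 j) (fun j (y : (ℕ → Plane) × (ℕ → Fin N × Bool × ℝ)) => (y.2 j).1)
    (fun j (y : (ℕ → Plane) × (ℕ → Fin N × Bool × ℝ)) => (y.2 j).2.1) (fun j (y : (ℕ → Plane) × (ℕ → Fin N × Bool × ℝ)) => (y.2 j).2.2) i
  have hX : Measurable fun ω j => X j ω := measurable_pi_lambda _ h.users.measurable_point
  have hM : Measurable fun ω j => (C j ω, A j ω, H j ω) := measurable_pi_lambda _ fun j =>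
    (h.measurable_cache j).prodMk ((h.measurable_active j).prodMk (h.measurable_fading j))
  have hY : Measurable Y := hX.prodMk hM
  have hL : Measurable fun ω => (J ω, G ω) := h.measurable_request.prodMk h.measurable_gain
  have hnu : Measurable nu := D2DParams.measurable_nearest (fun j => by fun_prop)
    (fun j => by fun_prop) i
  have hlu : Measurable lu := D.measurable_linkLoad (fun j => by fun_prop) (fun j => by fun_prop)
    (fun j => by fun_prop) (fun j => by fun_prop) i
  have := Measure.isProbabilityMeasure_map (μ := P) hL.aemeasurable
  let T : Set (((ℕ → Plane) × (ℕ → Fin N × Bool × ℝ)) × (Fin N × ℝ)) :=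
    {p | p.2.1 = i ∧ nu p.1 < ENNReal.ofReal r ∧ x * lu p.1 ≤ p.2.2}
  have hT : MeasurableSet T := by
    refine ((measurableSet_singleton i).preimage (measurable_fst.comp measurable_snd)).inter
      ((measurableSet_lt (hnu.comp measurable_fst) measurable_const).inter
      (measurableSet_le ((hlu.comp measurable_fst).const_mul x)
        (measurable_snd.comp measurable_snd)))
  have hmap := h.indep_users_link.map_prod_eq_prod_map_map hY.aemeasurable hL.aemeasurable
  have h1 : P {ω | J ω = i ∧ nearest X C i ω < ENNReal.ofReal r ∧
      x * D.linkLoad X C A H i ω ≤ G ω} = (P.map fun ω => (Y ω, (J ω, G ω))) T := by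
    rw [Measure.map_apply (hY.prodMk hL) hT]; rfl
  have hjg : ∀ z : ℝ, 0 ≤ z → (P.map fun ω => (J ω, G ω)) {q | q.1 = i ∧ z ≤ q.2} =
      ENNReal.ofReal (D.pr i * Real.exp (-z)) := by
    intro z hz
    have hQ : MeasurableSet {q : Fin N × ℝ | q.1 = i ∧ z ≤ q.2} :=
      ((measurableSet_singleton i).preimage measurable_fst).inter
        (measurableSet_le measurable_const measurable_snd)
    rw [Measure.map_apply hL hQ]
    have h2 := h.indep_request.measure_inter_preimage_eq_mul (s := {i}) (t := {y | z ≤ y})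
      (measurableSet_singleton i) measurableSet_Ici
    have h3 : P (J ⁻¹' {i}) = ENNReal.ofReal (D.pr i) := by
      rw [← h.law_request i, ofReal_measureReal]; rfl
    have h4 : P (G ⁻¹' {y | z ≤ y}) = ENNReal.ofReal (Real.exp (-z)) := by
      rw [← measure_ge_expMeasure hz]
      exact h.law_gain.measure_eq (p := fun y => z ≤ y) measurableSet_Ici
    rw [h3, h4, ← ENNReal.ofReal_mul (D.pr_nonneg i)] at h2
    exact h2
  have hnn : ∀ ω, 0 ≤ D.pr i * {ω | nearest X C i ω < ENNReal.ofReal r}.indicator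
      (fun ω => Real.exp (-(x * D.linkLoad X C A H i ω))) ω := fun ω =>
    mul_nonneg (D.pr_nonneg i) (indicator_nonneg (fun _ _ => Real.exp_nonneg _) _)
  have hm : MeasurableSet {ω | nearest X C i ω < ENNReal.ofReal r} :=
    measurableSet_lt (h.measurable_nearest i) measurable_const
  rw [measureReal_def, h1, hmap, Measure.prod_apply hT,
    lintegral_map (measurable_measure_prodMk_left hT) hY, coverage, ← integral_const_mul,
    integral_eq_lintegral_of_nonneg_ae (ae_of_all _ hnn)
      (((h.integrable_exp_linkLoad i hx).indicator hm).const_mul _).aestronglyMeasurable]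
  congr 1
  refine lintegral_congr_ae ?_
  filter_upwards [h.ae_fading_pos] with ω hω
  by_cases hn : nearest X C i ω < ENNReal.ofReal r
  · rw [indicator_of_mem (by exact hn), ← hjg _ (mul_nonneg hx (linkLoad_nonneg hω i))]
    congr 1
    ext q
    exact ⟨fun hq => ⟨hq.1, hq.2.2⟩, fun hq => ⟨hq.1, hn, hq.2⟩⟩
  · rw [indicator_of_notMem (by exact hn), mul_zero, ENNReal.ofReal_zero]
    have hempty : Prod.mk (Y ω) ⁻¹' T = ∅ := by
      ext q
      simp only [mem_preimage, mem_empty_iff_false, iff_false]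
      exact fun hq => hn hq.2.1
    rw [hempty, measure_empty]

end D2DParams.IsNetwork

/-! ### Law and mean of the energy. -/

namespace D2DParams

variable {N : ℕ} (D : D2DParams N)

/-- The energy spent on a link with SINR `γ` is `energyScale / log (1 + γ)`. -/
def energyScale : ℝ := D.F * Real.log 2 / D.W * (1 / D.eta * D.Pt + D.Pc)

theorem energyScale_pos : 0 < D.energyScale := by
  have := D.F_pos; have := D.W_pos; have := D.eta_pos; have := D.Pt_pos; have := D.Pc_nonneg
  have := Real.log_pos one_lt_two
  unfold energyScale; positivity

theorem budget_pos : 0 < D.budget := mul_pos (mul_pos D.rho_pos D.V0_pos) D.Q_pos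

theorem Gamma1_eq : D.Gamma1 = Real.exp (D.energyScale / D.budget) - 1 := by
  have := D.F_pos.ne'; have := D.W_pos.ne'; have := D.eta_pos.ne'; have := D.rho_pos.ne'
  have := D.V0_pos.ne'; have := D.Q_pos.ne'
  unfold Gamma1 energyScale budget
  congr 2
  field_simp

theorem log_one_add_Gamma1 : Real.log (1 + D.Gamma1) = D.energyScale / D.budget := by
  rw [D.Gamma1_eq, add_sub_cancel, Real.log_exp]

/-- Closed form of the probability that the requested file is cached within the collaboration
distance and that its link has signal to interference plus noise ratio at least `x`. -/
def servedProb (x : ℝ) : ℝ :=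
  ∑ i, D.pr i * ∫ r in (0 : ℝ)..D.rc, D.linkPdf i r * Real.exp (-D.phi i x r)

theorem linkPdf_nonneg (i : Fin N) {r : ℝ} (hr : 0 ≤ r) : 0 ≤ D.linkPdf i r := by
  have := D.lamFile_nonneg i; have := Real.pi_pos
  unfold linkPdf; positivity

theorem p1_pos : 0 < D.p1 := by
  have hc : ∀ i, Continuous fun r => D.linkPdf i r * Real.exp (-D.phi i D.Gamma1 r) := fun i =>
    (D.continuous_linkPdf i).mul (Real.continuous_exp.comp (D.continuous_phi i _).neg)
  obtain ⟨i, hi⟩ : ∃ i, 0 < D.pc i := by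
    by_contra hcon
    push Not at hcon
    have h1 := D.pc_sum
    have h2 : ∑ i, D.pc i ≤ 0 := Finset.sum_nonpos fun i _ => hcon i
    linarith
  unfold p1
  refine Finset.sum_pos' (fun k _ => mul_nonneg (D.pr_nonneg k) ?_) ⟨i, Finset.mem_univ i,
    mul_pos (D.pr_pos i) ?_⟩
  · refine intervalIntegral.integral_nonneg D.rc_pos.le fun r hr => ?_
    exact mul_nonneg (D.linkPdf_nonneg k hr.1) (Real.exp_nonneg _)
  · refine intervalIntegral.intervalIntegral_pos_of_pos_on ((hc i).intervalIntegrable _ _)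
      (fun r hr => ?_) D.rc_pos
    have hl : 0 < D.lamFile i := mul_pos D.lam_pos hi
    have hr0 : 0 < r := hr.1
    have := Real.pi_pos
    unfold linkPdf
    positivity

/-- Needed for Fubini's theorem. On `t > 0` the integral in `xi2` agrees with a continuous
primitive, which makes joint measurability evident. -/
theorem aestronglyMeasurable_linkPdf_mul_exp (i : Fin N) (c : ℝ) :
    AEStronglyMeasurable (fun p : ℝ × ℝ => D.linkPdf i p.1 * Real.exp
      (-D.phi i (Real.exp (1 / p.2) - 1) p.1))
      (((volume : Measure ℝ).restrict (Ioc 0 D.rc)).prod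
        ((volume : Measure ℝ).restrict (Ioc 0 c))) := by
  set prim : ℝ → ℝ := fun T => ∫ t in (0 : ℝ)..T,
      (Ioi (0 : ℝ)).indicator (fun t => 1 / (1 + t ^ (D.alpha / 2))) t with hprim
  have hpm : Measurable prim := D.continuous_primitive_xi.measurable
  have hpdf : Measurable (D.linkPdf i) := (D.continuous_linkPdf i).measurable
  have hg : Measurable fun p : ℝ × ℝ => D.linkPdf i p.1 * Real.exp
      (-((Real.exp (1 / p.2) - 1) * p.1 ^ D.alpha * (D.sigma2 / D.Pt) +
        Real.pi * (D.lamI * D.xi1 - D.lamDT i * prim ((Real.exp (1 / p.2) - 1) ^ (-(2 / D.alpha)))) *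
          p.1 ^ 2 * (Real.exp (1 / p.2) - 1) ^ (2 / D.alpha))) := by
    fun_prop
  refine hg.aestronglyMeasurable.congr ?_
  rw [Measure.prod_restrict]
  refine (ae_restrict_iff' (measurableSet_Ioc.prod measurableSet_Ioc)).2 (ae_of_all _ ?_)
  rintro ⟨r, t⟩ ⟨_, ht⟩
  have hx : 0 ≤ Real.exp (1 / t) - 1 := by
    rw [sub_nonneg, Real.one_le_exp_iff]; exact (one_div_pos.2 ht.1).le
  simp only [phi, xi2, hprim]
  rw [D.primitive_xi_eq (Real.rpow_nonneg hx _)]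

theorem measurable_linkEnergy {Ω : Type*} [MeasurableSpace Ω] {X : ℕ → Ω → Plane}
    {C : ℕ → Ω → Fin N} {A : ℕ → Ω → Bool} {H : ℕ → Ω → ℝ} {J : Ω → Fin N} {G : Ω → ℝ}
    (hX : ∀ j, Measurable (X j)) (hC : ∀ j, Measurable (C j)) (hA : ∀ j, Measurable (A j))
    (hH : ∀ j, Measurable (H j)) (hJ : Measurable J) (hG : Measurable G) :
    Measurable (D.linkEnergy X C A H J G) ∧ Measurable fun ω => nearest X C (J ω) ω := by
  have key : ∀ {β : Type} [MeasurableSpace β] (f : Fin N → Ω → β), (∀ i, Measurable (f i)) →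
      Measurable fun ω => f (J ω) ω := by
    intro β _ f hf
    have h1 : Measurable fun p : Ω × Fin N => f p.2 p.1 := measurable_from_prod_countable_left hf
    exact h1.comp (measurable_id.prodMk hJ)
  refine ⟨key (fun i ω => D.energy X C A H G i (nearest X C i ω).toReal ω) fun i => ?_,
    key (fun i => nearest X C i) fun i => measurable_nearest hX hC i⟩
  have hR := (measurable_nearest hX hC i).ennreal_toReal
  have hsum : Measurable fun ω => ∑' j, D.Pt * D.interferenceTerm X C A H i
      (nearest X C i ω).toReal ω j :=
    Measurable.tsum fun j => (D.measurable_interferenceTerm hX hC hA hH i hR j).const_mul _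
  have hsinr : Measurable fun ω => D.sinr X C A H G i (nearest X C i ω).toReal ω :=
    ((hG.const_mul _).mul (hR.pow_const _)).div (hsum.add_const _)
  have hrate : Measurable fun ω => D.rate X C A H G i (nearest X C i ω).toReal ω := by
    unfold rate Real.logb
    fun_prop
  exact (measurable_const.div hrate).mul_const _

namespace IsNetwork

variable {D} {Ω : Type*} [MeasurableSpace Ω] {P : Measure Ω} [IsProbabilityMeasure P]
  {X : ℕ → Ω → Plane} {C : ℕ → Ω → Fin N} {A : ℕ → Ω → Bool} {H : ℕ → Ω → ℝ} {J : Ω → Fin N}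
  {G : Ω → ℝ}

/-- The void probability of a ball tends to `1` as its radius shrinks. Distance `0` has to be
excluded because `0 ^ (-α) = 0` would falsify the identity between SINR and `G / linkLoad`. -/
theorem ae_nearest_ne_zero (h : D.IsNetwork P X C A H J G) (i : Fin N) :
    ∀ᵐ ω ∂P, nearest X C i ω ≠ 0 := by
  have hm : ∀ b : ℝ, MeasurableSet {ω | ENNReal.ofReal b ≤ nearest X C i ω} := fun b =>
    measurableSet_le measurable_const (h.measurable_nearest i)
  have hle : ∀ b : ℝ, 0 < b → P.real {ω | nearest X C i ω = 0} ≤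
      1 - Real.exp (-(D.lamFile i * Real.pi * b ^ 2)) := by
    intro b hb
    have h1 := (h.integral_exp_interference i hb.le le_rfl le_rfl).2
    simp only [interfExponent_zero, zero_mul, neg_zero, Real.exp_zero, add_zero] at h1
    rw [← h1, integral_indicator (hm b)]
    simp only [integral_const, smul_eq_mul, mul_one, measureReal_restrict_apply MeasurableSet.univ,
      univ_inter]
    rw [← probReal_compl_eq_one_sub (hm b)]
    refine measureReal_mono fun ω hω => ?_
    rw [mem_ofPred_eq] at hω
    simp [hω, hb]
  have hlim : Tendsto (fun b : ℝ => 1 - Real.exp (-(D.lamFile i * Real.pi * b ^ 2))) (𝓝[>] 0)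
      (𝓝 0) := by
    have hc : Continuous fun b : ℝ => 1 - Real.exp (-(D.lamFile i * Real.pi * b ^ 2)) := by fun_prop
    have := (hc.tendsto 0).mono_left (nhdsWithin_le_nhds (s := Ioi 0))
    simpa using this
  have h0 : P.real {ω | nearest X C i ω = 0} ≤ 0 := by
    refine ge_of_tendsto hlim ?_
    filter_upwards [self_mem_nhdsWithin] with b hb using hle b hb
  have h1 : P.real {ω | nearest X C i ω = 0} = 0 := le_antisymm h0 measureReal_nonneg
  rw [ae_iff]
  simp only [ne_eq, not_not]
  exact (measureReal_eq_zero_iff).1 h1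

/-- Here the SINR equals `G / linkLoad` and the energy `energyScale / log (1 + SINR)`, which is
inverted for the threshold on `G`. Finiteness is required because `toReal` sends `∞` to `0`. -/
theorem ae_linkEnergy (h : D.IsNetwork P X C A H J G) :
    ∀ᵐ ω ∂P, nearest X C (J ω) ω ≠ ∞ →
      0 ≤ D.linkEnergy X C A H J G ω ∧
      ∀ e, 0 < e → (D.linkEnergy X C A H J G ω ≤ e ↔
        (Real.exp (D.energyScale / e) - 1) * D.linkLoad X C A H (J ω) ω ≤ G ω) := by
  filter_upwards [h.ae_fading_pos, ae_all_iff.2 h.ae_nearest_ne_zero,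
    HasLaw.ae_pos_of_expMeasure h.law_gain] with ω hω hne hG hfin
  set i := J ω with hi
  set R := (nearest X C i ω).toReal with hR
  have hR0 : 0 < R := ENNReal.toReal_pos (hne i) hfin
  have hRα : 0 < R ^ D.alpha := Real.rpow_pos_of_pos hR0 _
  have hI := interference_nonneg (X := X) (C := C) (A := A) (D := D) hω i R
  have hload : 0 < D.linkLoad X C A H i ω :=
    mul_pos hRα (add_pos_of_nonneg_of_pos hI noise_pos)
  have hsinr : D.sinr X C A H G i R ω = G ω / D.linkLoad X C A H i ω := by
    have hPt := D.Pt_pos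
    unfold sinr linkLoad
    rw [tsum_mul_left, ← hR, Real.rpow_neg hR0.le]
    change D.Pt * G ω * (R ^ D.alpha)⁻¹ / (D.Pt * D.interference X C A H i R ω + D.sigma2) = _
    have h1 : D.Pt * D.interference X C A H i R ω + D.sigma2 =
        D.Pt * (D.interference X C A H i R ω + D.sigma2 / D.Pt) := by field_simp
    have h2 : 0 < D.interference X C A H i R ω + D.sigma2 / D.Pt :=
      add_pos_of_nonneg_of_pos hI noise_pos
    rw [h1]
    field_simp
  have hg0 : 0 < G ω / D.linkLoad X C A H i ω := div_pos hG hload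
  have hlog : 0 < Real.log (1 + G ω / D.linkLoad X C A H i ω) := Real.log_pos (by linarith)
  have hen : D.linkEnergy X C A H J G ω =
      D.energyScale / Real.log (1 + G ω / D.linkLoad X C A H i ω) := by
    have hl2 := Real.log_pos one_lt_two
    have := D.W_pos
    unfold linkEnergy energy rate energyScale
    rw [← hi, ← hR, hsinr, Real.logb]
    field_simp
  rw [hen]
  refine ⟨(div_pos D.energyScale_pos hlog).le, fun e he => ?_⟩
  rw [div_le_comm₀ hlog he, Real.le_log_iff_exp_le (by linarith), ← sub_le_iff_le_add',
    le_div_iff₀ hload]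

/-- The event that the requested file is served within the collaboration distance, with an energy
of at most `e`. -/
def servedWithin (D : D2DParams N) (X : ℕ → Ω → Plane) (C : ℕ → Ω → Fin N) (A : ℕ → Ω → Bool)
    (H : ℕ → Ω → ℝ) (J : Ω → Fin N) (G : Ω → ℝ) (e : ℝ) : Set Ω :=
  {ω | nearest X C (J ω) ω < ENNReal.ofReal D.rc ∧ D.linkEnergy X C A H J G ω ≤ e}

theorem measurableSet_servedWithin (h : D.IsNetwork P X C A H J G) (e : ℝ) :
    MeasurableSet (servedWithin D X C A H J G e) := by
  obtain ⟨h1, h2⟩ := D.measurable_linkEnergy h.users.measurable_point h.measurable_cache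
    h.measurable_active h.measurable_fading h.measurable_request h.measurable_gain
  exact (measurableSet_lt h2 measurable_const).inter (measurableSet_le h1 measurable_const)

theorem measureReal_servedWithin (h : D.IsNetwork P X C A H J G) {e : ℝ} (he : 0 < e) :
    P.real (servedWithin D X C A H J G e) =
      D.servedProb (Real.exp (D.energyScale / e) - 1) := by
  have hx : 0 < Real.exp (D.energyScale / e) - 1 := by
    rw [sub_pos, Real.one_lt_exp_iff]; exact div_pos D.energyScale_pos he
  set x := Real.exp (D.energyScale / e) - 1 with hxdef
  set S : Fin N → Set Ω := fun i => {ω | J ω = i ∧ nearest X C i ω < ENNReal.ofReal D.rc ∧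
      x * D.linkLoad X C A H i ω ≤ G ω} with hS
  have hSm : ∀ i, MeasurableSet (S i) := fun i =>
    ((measurableSet_singleton i).preimage h.measurable_request).inter
      ((measurableSet_lt (h.measurable_nearest i) measurable_const).inter
        (measurableSet_le ((h.measurable_linkLoad i).const_mul x) h.measurable_gain))
  have h1 : P.real (servedWithin D X C A H J G e) = P.real (⋃ i, S i) := by
    refine congrArg ENNReal.toReal (le_antisymm (measure_mono_ae ?_) (measure_mono_ae ?_))
    · filter_upwards [h.ae_linkEnergy] with ω hω hmem
      refine mem_iUnion.2 ⟨J ω, rfl, hmem.1, ?_⟩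
      exact ((hω (hmem.1.trans ENNReal.ofReal_lt_top).ne).2 e he).1 hmem.2
    · filter_upwards [h.ae_linkEnergy] with ω hω hmem
      obtain ⟨i, rfl, hn, hle⟩ := mem_iUnion.1 hmem
      exact ⟨hn, ((hω (hn.trans ENNReal.ofReal_lt_top).ne).2 e he).2 hle⟩
  rw [h1, measureReal_iUnion_fintype (fun i k hik => ?_) hSm]
  · refine Finset.sum_congr rfl fun i _ => ?_
    rw [h.measureReal_served i hx.le, h.coverage_eq i hx D.rc_pos.le]
  · exact Set.disjoint_left.2 fun ω hi hk => hik (hi.1.symm.trans hk.1)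

theorem complete_eq : D.complete X C A H J G = servedWithin D X C A H J G D.budget := rfl

theorem measureReal_complete (h : D.IsNetwork P X C A H J G) :
    P.real (D.complete X C A H J G) = D.p1 := by
  rw [complete_eq, h.measureReal_servedWithin D.budget_pos, ← D.Gamma1_eq]
  rfl

theorem ae_mem_complete (h : D.IsNetwork P X C A H J G) :
    ∀ᵐ ω ∂P, ω ∈ D.complete X C A H J G → 0 ≤ D.linkEnergy X C A H J G ω ∧
      D.linkEnergy X C A H J G ω ≤ D.budget := by
  filter_upwards [h.ae_linkEnergy] with ω hω hmem
  exact ⟨(hω (hmem.1.trans ENNReal.ofReal_lt_top).ne).1, hmem.2⟩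

theorem integrableOn_linkEnergy (h : D.IsNetwork P X C A H J G) :
    IntegrableOn (D.linkEnergy X C A H J G) (D.complete X C A H J G) P := by
  obtain ⟨h1, _⟩ := D.measurable_linkEnergy h.users.measurable_point h.measurable_cache
    h.measurable_active h.measurable_fading h.measurable_request h.measurable_gain
  refine Integrable.of_bound (C := D.budget) h1.aestronglyMeasurable ?_
  refine (ae_restrict_iff' (h.measurableSet_servedWithin _)).2 ?_
  filter_upwards [h.ae_mem_complete] with ω hω hmem
  rw [Real.norm_of_nonneg (hω hmem).1]
  exact (hω hmem).2

/-- Layer cake formula: for `t > 0`, a complete transmission saves at least `t` exactly when the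
request is served with energy at most `budget - t`. Reflecting `t` to `e = budget - t` gives the
integral. -/
theorem setIntegral_saved_energy (h : D.IsNetwork P X C A H J G) :
    ∫ ω in D.complete X C A H J G, (D.budget - D.linkEnergy X C A H J G ω) ∂P =
      ∫ e in (0 : ℝ)..D.budget, D.servedProb (Real.exp (D.energyScale / e) - 1) := by
  have hms : MeasurableSet (D.complete X C A H J G) := h.measurableSet_servedWithin D.budget
  have hint : IntegrableOn (fun ω => D.budget - D.linkEnergy X C A H J G ω)
      (D.complete X C A H J G) P := (integrable_const _).sub h.integrableOn_linkEnergy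
  rw [hint.integral_eq_integral_Ioc_meas_le (M := D.budget)
    ((ae_restrict_iff' hms).2 (by
      filter_upwards [h.ae_mem_complete] with ω hω hmem using sub_nonneg.2 (hω hmem).2))
    ((ae_restrict_iff' hms).2 (by
      filter_upwards [h.ae_mem_complete] with ω hω hmem using sub_le_self _ (hω hmem).1))]
  have h1 : ∫ t in Ioc 0 D.budget, (P.restrict (D.complete X C A H J G)).real
      {ω | t ≤ D.budget - D.linkEnergy X C A H J G ω} =
      ∫ t in Ioc 0 D.budget, P.real (servedWithin D X C A H J G (D.budget - t)) := by
    refine setIntegral_congr_fun measurableSet_Ioc fun t ht => ?_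
    rw [measureReal_restrict_apply' hms]
    congr 1
    ext ω
    simp only [mem_inter_iff, mem_ofPred_eq, complete, servedWithin]
    constructor
    · rintro ⟨h1, h2, _⟩; exact ⟨h2, by linarith⟩
    · rintro ⟨h1, h2⟩; exact ⟨by linarith, h1, by linarith [ht.1]⟩
  rw [h1, ← intervalIntegral.integral_of_le D.budget_pos.le,
    intervalIntegral.integral_comp_sub_left
      (fun e => P.real (servedWithin D X C A H J G e)) D.budget, sub_self, sub_zero]
  refine intervalIntegral.integral_congr_ae (ae_of_all _ fun e he => ?_)
  rw [uIoc_of_le D.budget_pos.le] at he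
  exact h.measureReal_servedWithin he.1

/-- Up to the noise term, `phi` is the mean number of thinned users for void radius `0`. This
provides the domination for Fubini's theorem. -/
theorem phi_nonneg (h : D.IsNetwork P X C A H J G) (i : Fin N) {x r : ℝ} (hx : 0 < x)
    (hr : 0 < r) : 0 ≤ D.phi i x r := by
  have hs : 0 ≤ x * r ^ D.alpha := mul_nonneg hx.le (Real.rpow_nonneg hr.le _)
  have h1 := (D.integral_thinning i le_rfl hr.le hs).2
  have h2 : 0 ≤ ∫ y, D.thinning i 0 r (x * r ^ D.alpha) y :=
    integral_nonneg fun y => h.thinning_nonneg i hs y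
  have h3 := mul_nonneg D.lam_pos.le h2
  rw [D.phi_eq i hx hr]
  have h4 := mul_nonneg hs (noise_pos (D := D)).le
  nlinarith

theorem integral_servedProb (h : D.IsNetwork P X C A H J G) {c : ℝ} (hc : 0 ≤ c) :
    ∫ t in (0 : ℝ)..c, D.servedProb (Real.exp (1 / t) - 1) =
      ∑ i, D.pr i * ∫ r in (0 : ℝ)..D.rc, D.linkPdf i r *
        ∫ t in (0 : ℝ)..c, Real.exp (-D.phi i (Real.exp (1 / t) - 1) r) := by
  have hint : ∀ i, Integrable (fun p : ℝ × ℝ => D.linkPdf i p.1 * Real.exp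
      (-D.phi i (Real.exp (1 / p.2) - 1) p.1))
      (((volume : Measure ℝ).restrict (Ioc 0 D.rc)).prod
        ((volume : Measure ℝ).restrict (Ioc 0 c))) := by
    intro i
    obtain ⟨B, hB⟩ := (isCompact_Icc (a := (0 : ℝ)) (b := D.rc)).exists_bound_of_continuousOn
      (D.continuous_linkPdf i).continuousOn
    refine Integrable.of_bound (C := B) (D.aestronglyMeasurable_linkPdf_mul_exp i c) ?_
    rw [Measure.prod_restrict]
    refine (ae_restrict_iff' (measurableSet_Ioc.prod measurableSet_Ioc)).2 (ae_of_all _ ?_)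
    rintro ⟨r, t⟩ ⟨hr, ht⟩
    have hx : 0 < Real.exp (1 / t) - 1 := by
      rw [sub_pos, Real.one_lt_exp_iff]; exact one_div_pos.2 ht.1
    rw [norm_mul, Real.norm_of_nonneg (Real.exp_nonneg _)]
    refine (mul_le_of_le_one_right (norm_nonneg _) ?_).trans (hB r ⟨hr.1.le, hr.2⟩)
    exact Real.exp_le_one_iff.2 (neg_nonpos.2 (h.phi_nonneg i hx hr.1))
  unfold servedProb
  simp_rw [intervalIntegral.integral_of_le D.rc_pos.le, intervalIntegral.integral_of_le hc]
  rw [integral_finsetSum]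
  · refine Finset.sum_congr rfl fun i _ => ?_
    rw [integral_const_mul, ← integral_integral_swap (f := fun r t => D.linkPdf i r * Real.exp
      (-D.phi i (Real.exp (1 / t) - 1) r)) (hint i)]
    simp_rw [integral_const_mul]
  · intro i _
    exact (hint i).integral_prod_right.const_mul _

theorem setIntegral_linkEnergy (h : D.IsNetwork P X C A H J G) :
    ∫ ω in D.complete X C A H J G, D.linkEnergy X C A H J G ω ∂P =
      D.budget * D.p1 - D.budget * ∑ i, D.pr i *
        ∫ r in (0 : ℝ)..D.rc, D.linkPdf i r * Real.log (1 + D.Gamma1) *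
          ∫ t in (0 : ℝ)..1 / Real.log (1 + D.Gamma1),
            Real.exp (-D.phi i (Real.exp (1 / t) - 1) r) := by
  have h1 := h.setIntegral_saved_energy
  rw [integral_sub (integrable_const _) h.integrableOn_linkEnergy] at h1
  simp only [integral_const, smul_eq_mul, measureReal_restrict_apply MeasurableSet.univ,
    univ_inter, h.measureReal_complete] at h1
  have hb := D.budget_pos
  have hs := D.energyScale_pos
  have hc : 1 / Real.log (1 + D.Gamma1) = D.budget / D.energyScale := by
    rw [D.log_one_add_Gamma1, one_div_div]
  have h2 := h.integral_servedProb (c := D.budget / D.energyScale) (by positivity)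
  -- Substitution `e = energyScale * t`; the upper limit becomes `budget / energyScale = 1 / log (1
  -- + Gamma1)`.
  have h3 := intervalIntegral.integral_comp_mul_left (a := 0) (b := D.budget / D.energyScale)
    (fun e => D.servedProb (Real.exp (D.energyScale / e) - 1)) hs.ne'
  rw [mul_zero, mul_div_cancel₀ _ hs.ne', smul_eq_mul] at h3
  have h4 : ∀ t : ℝ, D.energyScale / (D.energyScale * t) = 1 / t := fun t => by
    rw [← div_div, div_self hs.ne']
  simp_rw [h4] at h3
  rw [h2] at h3
  have h5 : ∀ i, ∫ r in (0 : ℝ)..D.rc, D.linkPdf i r * Real.log (1 + D.Gamma1) *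
          ∫ t in (0 : ℝ)..1 / Real.log (1 + D.Gamma1),
            Real.exp (-D.phi i (Real.exp (1 / t) - 1) r) =
      D.energyScale / D.budget * ∫ r in (0 : ℝ)..D.rc, D.linkPdf i r *
          ∫ t in (0 : ℝ)..D.budget / D.energyScale,
            Real.exp (-D.phi i (Real.exp (1 / t) - 1) r) := by
    intro i
    rw [hc, D.log_one_add_Gamma1, ← intervalIntegral.integral_const_mul]
    refine intervalIntegral.integral_congr fun r _ => ?_
    ring
  have h6 : ∑ i, D.pr i * ∫ r in (0 : ℝ)..D.rc, D.linkPdf i r * Real.log (1 + D.Gamma1) *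
          ∫ t in (0 : ℝ)..1 / Real.log (1 + D.Gamma1),
            Real.exp (-D.phi i (Real.exp (1 / t) - 1) r) =
      D.energyScale / D.budget * (D.energyScale⁻¹ * ∫ e in (0 : ℝ)..D.budget,
        D.servedProb (Real.exp (D.energyScale / e) - 1)) := by
    rw [← h3, Finset.mul_sum]
    refine Finset.sum_congr rfl fun i _ => ?_
    rw [h5]; ring
  rw [h6, ← h1]
  field_simp
  ring

end IsNetwork

end D2DParams

end

theorem proposition5 {N : ℕ} (D : D2DParams N) {Ω : Type*} [MeasurableSpace Ω]
    (P : Measure Ω) [IsProbabilityMeasure P] (X : ℕ → Ω → Plane) (C : ℕ → Ω → Fin N)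
    (A : ℕ → Ω → Bool) (H : ℕ → Ω → ℝ) (J : Ω → Fin N) (G : Ω → ℝ)
    (hnet : D.IsNetwork P X C A H J G) :
    -- the interference is almost surely a convergent series
    (∀ᵐ ω ∂P, ∀ (i : Fin N) (r : ℝ), Summable (D.interferenceTerm X C A H i r ω)) ∧
    -- a complete transmission has the positive probability `p₁`
    0 < D.p1 ∧ P.real (D.complete X C A H J G) = D.p1 ∧
    -- mean energy given a complete transmission
    Integrable (D.linkEnergy X C A H J G) (P[|D.complete X C A H J G]) ∧
    ∫ ω, D.linkEnergy X C A H J G ω ∂(P[|D.complete X C A H J G]) =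
      D.rho * D.V0 * D.Q - D.rho * D.V0 * D.Q * ∑ i, D.pr i / D.p1 *
        ∫ r in (0 : ℝ)..D.rc, D.linkPdf i r * Real.log (1 + D.Gamma1) *
          ∫ t in (0 : ℝ)..1 / Real.log (1 + D.Gamma1),
            Real.exp (-D.phi i (Real.exp (1 / t) - 1) r) := by
  have hp := D.p1_pos
  have hreal := hnet.measureReal_complete
  have hP : P (D.complete X C A H J G) ≠ 0 := by
    intro h0
    rw [measureReal_def, h0, ENNReal.toReal_zero] at hreal
    exact hp.ne hreal
  refine ⟨hnet.ae_summable, hp, hreal, ?_, ?_⟩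
  · rw [ProbabilityTheory.cond]
    exact hnet.integrableOn_linkEnergy.smul_measure (ENNReal.inv_ne_top.2 hP)
  · have hb : D.rho * D.V0 * D.Q = D.budget := rfl
    -- Conditioning divides by `p1`, which cancels in the term `budget * p1` and enters the weights
    -- of the sum.
    rw [ProbabilityTheory.cond, integral_smul_measure, hnet.setIntegral_linkEnergy,
      ENNReal.toReal_inv, ← measureReal_def, hreal, smul_eq_mul, hb]
    have hdiv : ∀ (i : Fin N) (z : ℝ), D.pr i / D.p1 * z = D.p1⁻¹ * (D.pr i * z) := fun i z => by
      rw [div_eq_mul_inv]; ring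
    simp_rw [hdiv]
    rw [← Finset.mul_sum, mul_sub, mul_left_comm D.p1⁻¹, inv_mul_cancel₀ hp.ne', mul_one,
      mul_left_comm D.p1⁻¹]
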